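/- Let $\sigma:\mathbb{R}\to\mathbb{R}$ be a continuous function that is not affine (the activation, applied entrywise), let $n,d\ge 0$ be integers and let $H\le S_d$. **Groups.** Let $G=S_n\times H$ and $W=H^n\rtimes S_n$ (wreath product) be the groups of permutations of $\{1,\dots,n\}\times\{1,\dots,d\}$ that act on matrices $X\in\mathbb{R}^{n\times d}$ with rows $x_1,\dots,x_n\in\mathbb{R}^d$ by $$((q,h)\cdot X)_{ij}=X_{q^{-1}(i),\,h^{-1}(j)},\qquad ((h_1,\dots,h_n,q)\cdot X)_{ij}=X_{q^{-1}(i),\,h_i^{-1}(j)} .$$ **Networks.** A multilayer perceptron (MLP) is a composition $A_k\circ\sigma\circ\dots\circ\sigma\circ A_1$, $k\ge1$, of affine maps between spaces $\mathbb{R}^a$; it has a hidden layer if $k\ge2$. For a group $\Gamma$ of permutations of a finite set of $\ell$ coordinates, a $\Gamma$-equivariant network is a composition $f=L_k\circ\sigma\circ\dots\circ\sigma\circ L_1$, $k\ge1$, of $\Gamma$-equivariant affine maps $L_i:\mathbb{R}^{\ell\times a_i}\to\mathbb{R}^{\ell\times a_{i+1}}$ ($\Gamma$ permutes the $\ell$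 coordinates, the $a_i$ are numbers of feature channels), and a $\Gamma$-invariant network is a map $m\circ\sigma\circ h\circ\sigma\circ f$ with $f$ a $\Gamma$-equivariant network, $h:\mathbb{R}^{\ell\times p}\to\mathbb{R}^{r}$ a $\Gamma$-invariant affine map and $m$ an MLP. A *DSS network* is a $G$-invariant network on $\mathbb{R}^{n\times d}$ (one input channel). A *Siamese network* is a map $X\mapsto M\big(\sum_{i=1}^n\varphi(x_i)\big)$ with $\varphi$ an $H$-invariant network on $\mathbb{R}^d$ (one input channel) and $M$ an MLP. All widths and depths are arbitrary, and outputs are in $\mathbb{R}^b$ for arbitrary $b$. A family of networks is *universal* for $\Gamma$-invariant functions if for every $b$, every compact $\Gamma$-invariant set $K$ of inputs, every continuous $\Gamma$-invariant $f:K\to\mathbb{R}^b$ and every $\varepsilon>0$ it contains a network $N$ with $\|N(x)-f(x)\|_\infty<\varepsilon$ for all $x\in K$. For a class $\mathcal N$ of networks with outputs in $\mathbb{R}^b$, let $\overline{\mathcal N}$ be the set of functions that members of $\mathcal N$ approximate uniformly, to any accuracy, on every compact set. Let $\mathcal{E}\subset\mathbb{R}^{n\times d}$ be the set of $X$ for which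 two distinct entries of the vector $\sum_i x_i\in\mathbb{R}^d$ are equal. **Statement.** 1. $G\le W$, and $G\ne W$ if $n\ge2$ and $H$ is nontrivial. DSS networks are $G$-invariant and Siamese networks are $W$-invariant. 2. Suppose that $H$-invariant networks on $\mathbb{R}^{d\times c}$ are universal for $H$-invariant functions, for every number $c$ of input channels. Then Siamese networks are universal for $W$-invariant functions on $\mathbb{R}^{n\times d}$, and for any $X,Y\notin\mathcal{E}$ in different $G$-orbits there is a DSS network $F:\mathbb{R}^{n\times d}\to\mathbb{R}$ with $F(X)\ne F(Y)$. 3. DSS networks simulate Siamese networks: every Siamese network whose final MLP has a hidden layer is (as a function) a DSS network, and $\overline{\{\text{Siamese}\}}\subseteq\overline{\{\text{DSS}\}}$ for every output dimension $b$. 4. If $n\ge2$ and $H$ is nontrivial, then there are $X,Y\notin\mathcal{E}$ in the same $W$-orbit but in different $G$-orbits such that some DSS network $F:\mathbb{R}^{n\times d}\to\mathbb{R}$ has $F(X)\ne F(Y)$, while every Siamese network $F$ has $F(X)=F(Y)$. 5. If $n\ge2$ and $H$ is nontrivial, then DSS networks are strictly more expressive than Siamese networks: for every $b\ge1$, $\overline{\{\text{Siamese}\}}\subsetneq\overline{\{\text{DSS}\}}$,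 and some DSS network with outputs in $\mathbb{R}^b$ is not in $\overline{\{\text{Siamese}\}}$. -/

import Mathlib

namespace SymmetricSets

open Equiv

/-- The action of permutations on coordinates: `(g · x) i = x (g⁻¹ i)`. -/
def permute {ι V : Type*} (g : Perm ι) (x : ι → V) : ι → V := fun i => x (g⁻¹ i)

/-- `y` lies in the `G`-orbit of `x`, where `G` permutes coordinates. -/
def SameOrbit {ι V : Type*} (G : Subgroup (Perm ι)) (x y : ι → V) : Prop :=
  ∃ g ∈ G, permute g x = y

/-! ### Networks -/

/-- Multilayer perceptrons `A_k ∘ σ ∘ A_{k-1} ∘ ⋯ ∘ σ ∘ A_1` with affine layers `A_i`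
(`k ≥ 1`) and the activation `σ` applied to each entry. -/
inductive IsMLP (σ : ℝ → ℝ) {a : ℕ} : {b : ℕ} → ((Fin a → ℝ) → (Fin b → ℝ)) → Prop
  | single {b : ℕ} (A : (Fin a → ℝ) →ᵃ[ℝ] (Fin b → ℝ)) : IsMLP σ (fun v => A v)
  | cons {b c : ℕ} (M : (Fin a → ℝ) → (Fin b → ℝ)) (hM : IsMLP σ M)
      (A : (Fin b → ℝ) →ᵃ[ℝ] (Fin c → ℝ)) : IsMLP σ (fun v => A (fun k => σ (M v k)))

/-- An equivariant layer with `a` input and `b` output feature channels (a linear map with a bias,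
that is, an affine map). -/
def IsEquivariantLayer {ι : Type*} (G : Subgroup (Perm ι)) {a b : ℕ}
    (L : (ι → Fin a → ℝ) →ᵃ[ℝ] (ι → Fin b → ℝ)) : Prop :=
  ∀ g ∈ G, ∀ x, L (permute g x) = permute g (L x)

/-- An invariant layer with `a` input feature channels (a linear map with a bias). -/
def IsInvariantLayer {ι : Type*} (G : Subgroup (Perm ι)) {a b : ℕ}
    (h : (ι → Fin a → ℝ) →ᵃ[ℝ] (Fin b → ℝ)) : Prop :=
  ∀ g ∈ G, ∀ x, h (permute g x) = h x

/-- `G`-equivariant networks `L_k ∘ σ ∘ L_{k-1} ∘ ⋯ ∘ σ ∘ L_1` with equivariant layers `L_i`. -/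
inductive IsEquivariantNetwork (σ : ℝ → ℝ) {ι : Type*} (G : Subgroup (Perm ι)) {a : ℕ} :
    {b : ℕ} → ((ι → Fin a → ℝ) → (ι → Fin b → ℝ)) → Prop
  | single {b : ℕ} (L : (ι → Fin a → ℝ) →ᵃ[ℝ] (ι → Fin b → ℝ)) (hL : IsEquivariantLayer G L) :
      IsEquivariantNetwork σ G (fun x => L x)
  | cons {b c : ℕ} (f : (ι → Fin a → ℝ) → (ι → Fin b → ℝ)) (hf : IsEquivariantNetwork σ G f)
      (L : (ι → Fin b → ℝ) →ᵃ[ℝ] (ι → Fin c → ℝ)) (hL : IsEquivariantLayer G L) :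
      IsEquivariantNetwork σ G (fun x => L (fun i k => σ (f x i k)))

/-- `G`-invariant networks `m ∘ σ ∘ h ∘ σ ∘ f`, with `f` a `G`-equivariant network, `h` an
invariant layer and `m` a multilayer perceptron; `c` input channels and outputs in `ℝ^b`. -/
def invariantNetworks (σ : ℝ → ℝ) {ι : Type*} (G : Subgroup (Perm ι)) (c b : ℕ) :
    Set ((ι → Fin c → ℝ) → (Fin b → ℝ)) :=
  {N | ∃ (p q : ℕ) (f : (ι → Fin c → ℝ) → (ι → Fin p → ℝ))
      (h : (ι → Fin p → ℝ) →ᵃ[ℝ] (Fin q → ℝ)) (m : (Fin q → ℝ) → (Fin b → ℝ)),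
      IsEquivariantNetwork σ G f ∧ IsInvariantLayer G h ∧ IsMLP σ m ∧
      ∀ x, N x = m (fun l => σ (h (fun i k => σ (f x i k)) l))}

/-! ### Symmetry groups of sets of `n` elements of `ℝ^d`

A set of elements is a matrix `X : Fin n × Fin d → ℝ`, with one element per row. -/

/-- `S_n × H`, acting by `((q, h) · X) (i, j) = X (q⁻¹ i, h⁻¹ j)`. -/
def productGroup (n : ℕ) {d : ℕ} (H : Subgroup (Perm (Fin d))) :
    Subgroup (Perm (Fin n × Fin d)) where
  carrier := {g | ∃ q : Perm (Fin n), ∃ h ∈ H, ∀ i j, g (i, j) = (q i, h j)}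
  one_mem' := ⟨1, 1, H.one_mem, fun _ _ => rfl⟩
  mul_mem' := by
    rintro g g' ⟨q, h, hh, hg⟩ ⟨q', h', hh', hg'⟩
    exact ⟨q * q', h * h', H.mul_mem hh hh', fun i j => by simp [hg, hg']⟩
  inv_mem' := by
    rintro g ⟨q, h, hh, hg⟩
    exact ⟨q⁻¹, h⁻¹, H.inv_mem hh, fun i j => by rw [Perm.inv_eq_iff_eq]; simp [hg]⟩

/-- The wreath product `H^n ⋊ S_n`, acting by
`((h_1, …, h_n, q) · X) (i, j) = X (q⁻¹ i, h_i⁻¹ j)`. -/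
def wreathGroup (n : ℕ) {d : ℕ} (H : Subgroup (Perm (Fin d))) :
    Subgroup (Perm (Fin n × Fin d)) where
  carrier := {g | ∃ (q : Perm (Fin n)) (h : Fin n → Perm (Fin d)), (∀ i, h i ∈ H) ∧
    ∀ i j, g (i, j) = (q i, h (q i) j)}
  one_mem' := ⟨1, fun _ => 1, fun _ => H.one_mem, fun _ _ => rfl⟩
  mul_mem' := by
    rintro g g' ⟨q, h, hh, hg⟩ ⟨q', h', hh', hg'⟩
    exact ⟨q * q', fun i => h i * h' (q⁻¹ i), fun i => H.mul_mem (hh _) (hh' _),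
      fun i j => by simp [hg, hg']⟩
  inv_mem' := by
    rintro g ⟨q, h, hh, hg⟩
    exact ⟨q⁻¹, fun i => (h (q i))⁻¹, fun i => H.inv_mem (hh _),
      fun i j => by rw [Perm.inv_eq_iff_eq]; simp [hg]⟩

/-- View an input with one number per coordinate as an input with one feature channel. -/
def oneChannel {ι : Type*} (x : ι → ℝ) : ι → Fin 1 → ℝ := fun i _ => x i

/-- The `i`-th element of a set. -/
def row {n d : ℕ} (X : Fin n × Fin d → ℝ) (i : Fin n) : Fin d → ℝ := fun j => X (i, j)

/-- Invariant DSS networks: `(S_n × H)`-invariant networks on `ℝ^{n × d}`, with outputs in `ℝ^b`. -/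
def dssNetworks (σ : ℝ → ℝ) (n : ℕ) {d : ℕ} (H : Subgroup (Perm (Fin d))) (b : ℕ) :
    Set ((Fin n × Fin d → ℝ) → (Fin b → ℝ)) :=
  {F | ∃ N ∈ invariantNetworks σ (productGroup n H) 1 b, ∀ X, F X = N (oneChannel X)}

/-- Siamese networks: an `H`-invariant network `φ` is applied to each element, the results are
summed, and a multilayer perceptron `M` is applied to the sum. -/
def siameseNetworks (σ : ℝ → ℝ) (n : ℕ) {d : ℕ} (H : Subgroup (Perm (Fin d))) (b : ℕ) :
    Set ((Fin n × Fin d → ℝ) → (Fin b → ℝ)) :=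
  {F | ∃ (a : ℕ) (φ : (Fin d → Fin 1 → ℝ) → (Fin a → ℝ)) (M : (Fin a → ℝ) → (Fin b → ℝ)),
      φ ∈ invariantNetworks σ H 1 a ∧ IsMLP σ M ∧
      ∀ X, F X = M (∑ i, φ (oneChannel (row X i)))}

/-! ### Approximation -/

/-- The functions that members of `𝒩` approximate uniformly on every compact set. -/
def approximable {E : Type*} [TopologicalSpace E] {b : ℕ} (𝒩 : Set (E → (Fin b → ℝ))) :
    Set (E → (Fin b → ℝ)) :=
  {f | ∀ K : Set E, IsCompact K → ∀ ε > 0, ∃ N ∈ 𝒩, ∀ x ∈ K, dist (N x) (f x) < ε}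

/-- The family `𝒩` (one set of functions for each output dimension) is universal for `G`-invariant
functions: on every compact `G`-invariant set, every continuous `G`-invariant function is
uniformly approximated by members of `𝒩`. -/
def UniversalInvariant {ι V : Type*} [TopologicalSpace V] (G : Subgroup (Perm ι))
    (𝒩 : ∀ b : ℕ, Set ((ι → V) → (Fin b → ℝ))) : Prop :=
  ∀ (b : ℕ) (K : Set (ι → V)), IsCompact K → (∀ g ∈ G, ∀ x ∈ K, permute g x ∈ K) →
    ∀ f : (ι → V) → (Fin b → ℝ), ContinuousOn f K → (∀ g ∈ G, ∀ x ∈ K, f (permute g x) = f x) →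
      ∀ ε > 0, ∃ N ∈ 𝒩 b, ∀ x ∈ K, dist (N x) (f x) < ε

/-- The exceptional set: two entries of the sum of all elements coincide. -/
def exceptionalSet (n d : ℕ) : Set (Fin n × Fin d → ℝ) :=
  {X | ∃ j k : Fin d, j ≠ k ∧ ∑ i, X (i, j) = ∑ i, X (i, k)}

end SymmetricSets

open SymmetricSets

namespace SymmetricSets

open Equiv

/-! ### Permutations and orbits -/

section Groups

variable {ι V : Type*}

/-! A Siamese network sees only the multiset of `H`-orbits of the rows. A DSS network can also mix
rows, and the one mixing layer needed is `appendRowSum`, which gives every row the column sums as a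
second channel. If these sums are pairwise distinct, matching them forces one element of `H` to
serve all rows. The multiset of `H`-orbits of the augmented rows then determines the orbit under
`S_n × H` (`exists_dssNetwork_ne`).

Both positive results under the universality hypothesis rest on `exists_perm_sameOrbit`: sums of
continuous invariant functions recover the multiset of orbits. Stone–Weierstrass on the orbit space
turns this into approximation (`exists_rowSum_near`), after which networks replace the continuous
functions. The outer perceptron needs universality for a merely continuous, non-affine `σ`.
Averaging smooths `σ`, a rescaled second difference yields `t ^ 2` (`sqMap_mem_ridgeSpan`), and
polarization yields products, hence density of perceptrons (`closure_mlpSet_eq_univ`).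

Simulation works because an `H`-equivariant network run on each row is equivariant under `S_n × H`
(`sum_rows_mem_invariantNetworks`). For strictness, `exists_sameOrbit_columnSums_ne` gives two
inputs in one wreath orbit whose column sums have different sums of squares. Since `t ^ 2` is a
limit of combinations of `σ (a t + b)`, some DSS network tells them apart, while limits of Siamese
networks cannot. -/

@[simp] lemma permute_apply (g : Perm ι) (x : ι → V) (i : ι) : permute g x i = x (g⁻¹ i) := rfl

@[simp] lemma permute_one (x : ι → V) : permute 1 x = x := rfl

lemma permute_mul (g h : Perm ι) (x : ι → V) : permute (g * h) x = permute g (permute h x) := by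
  funext i
  simp [mul_inv_rev]

lemma permute_eq_iff {g : Perm ι} {x y : ι → V} : permute g x = y ↔ ∀ i, x i = y (g i) := by
  constructor
  · rintro rfl i
    simp
  · intro h
    funext i
    simp [h]

lemma continuous_permute [TopologicalSpace V] (g : Perm ι) :
    Continuous (permute g : (ι → V) → (ι → V)) :=
  continuous_pi fun i => continuous_apply (g⁻¹ i)

lemma SameOrbit.refl (G : Subgroup (Perm ι)) (x : ι → V) : SameOrbit G x x :=
  ⟨1, G.one_mem, rfl⟩

lemma SameOrbit.symm {G : Subgroup (Perm ι)} {x y : ι → V} (h : SameOrbit G x y) :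
    SameOrbit G y x := by
  obtain ⟨g, hg, rfl⟩ := h
  exact ⟨g⁻¹, G.inv_mem hg, by rw [← permute_mul]; simp⟩

lemma SameOrbit.trans {G : Subgroup (Perm ι)} {x y z : ι → V} (h : SameOrbit G x y)
    (h' : SameOrbit G y z) : SameOrbit G x z := by
  obtain ⟨g, hg, rfl⟩ := h
  obtain ⟨g', hg', rfl⟩ := h'
  exact ⟨g' * g, G.mul_mem hg' hg, permute_mul _ _ _⟩

/-- The setoid of orbits. -/
def orbitSetoid (G : Subgroup (Perm ι)) (V : Type*) : Setoid (ι → V) where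
  r := SameOrbit G
  iseqv := ⟨SameOrbit.refl G, SameOrbit.symm, SameOrbit.trans⟩

variable {n d : ℕ} {H : Subgroup (Perm (Fin d))}

lemma productGroup_le_wreathGroup : productGroup n H ≤ wreathGroup n H := by
  rintro g ⟨q, h, hh, hg⟩
  exact ⟨q, fun _ => h, fun _ => hh, hg⟩

lemma prodCongr_mem_productGroup (q : Perm (Fin n)) {h : Perm (Fin d)} (hh : h ∈ H) :
    (Equiv.prodCongr q h : Perm (Fin n × Fin d)) ∈ productGroup n H :=
  ⟨q, h, hh, fun _ _ => rfl⟩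

lemma prodShear_mem_wreathGroup (q : Perm (Fin n)) {h : Fin n → Perm (Fin d)}
    (hh : ∀ i, h i ∈ H) : (Equiv.prodShear q h : Perm (Fin n × Fin d)) ∈ wreathGroup n H :=
  -- `prodShear` indexes the column permutations by the source row, `wreathGroup` by the target row.
  ⟨q, fun i => h (q⁻¹ i), fun _ => hh _, fun i j => by simp [Equiv.prodShear]⟩

lemma exists_mem_ne_one_of_ne_bot {G : Type*} [Group G] {H : Subgroup G} (hH : H ≠ ⊥) :
    ∃ h ∈ H, h ≠ 1 := by
  by_contra! hc
  exact hH ((Subgroup.eq_bot_iff_forall H).2 hc)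

/-- The witness permutes the columns of row 0 by some `h ≠ 1` and fixes every other row. In the
product group rows 0 and 1 would share their column permutation, forcing `h = 1`. -/
lemma productGroup_lt_wreathGroup (hn : 2 ≤ n) (hH : H ≠ ⊥) :
    productGroup n H < wreathGroup n H := by
  refine lt_of_le_of_ne productGroup_le_wreathGroup fun heq => ?_
  obtain ⟨h, hh, h1⟩ := exists_mem_ne_one_of_ne_bot hH
  let i₀ : Fin n := ⟨0, by omega⟩
  let i₁ : Fin n := ⟨1, by omega⟩
  have hmem := prodShear_mem_wreathGroup (1 : Perm (Fin n)) (H := H)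
    (h := fun i => if i = i₀ then h else 1) (fun i => by
      split_ifs
      exacts [hh, H.one_mem])
  rw [← heq] at hmem
  obtain ⟨q, h', -, hg⟩ := hmem
  have hne : i₁ ≠ i₀ := by simp [i₀, i₁]
  refine h1 (Equiv.ext fun j => ?_)
  have e₀ := congrArg Prod.snd (hg i₀ j)
  have e₁ := congrArg Prod.snd (hg i₁ j)
  simp only [Equiv.prodShear, coe_fn_mk, if_true, if_neg hne] at e₀ e₁
  rw [e₀, ← e₁]

/-- The orbits of the product group, in terms of rows. -/
lemma sameOrbit_productGroup_of_rows {X Y : Fin n × Fin d → V} (q : Perm (Fin n))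
    {h : Perm (Fin d)} (hh : h ∈ H) (hXY : ∀ i j, X (i, j) = Y (q i, h j)) :
    SameOrbit (productGroup n H) X Y :=
  ⟨_, prodCongr_mem_productGroup q hh, permute_eq_iff.2 fun ⟨i, j⟩ => hXY i j⟩

/-- The orbits of the wreath product, in terms of rows. -/
lemma sameOrbit_wreathGroup_of_rows {X Y : Fin n × Fin d → ℝ} (q : Perm (Fin n))
    (hXY : ∀ i, SameOrbit H (row X i) (row Y (q i))) : SameOrbit (wreathGroup n H) X Y := by
  choose h hh hXY using hXY
  exact ⟨_, prodShear_mem_wreathGroup q hh, permute_eq_iff.2 fun ⟨i, j⟩ =>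
    permute_eq_iff.1 (hXY i) j⟩

end Groups

/-! ### Invariance and continuity of networks -/

section Networks

variable {σ : ℝ → ℝ} {ι : Type*} {G : Subgroup (Perm ι)}

lemma IsEquivariantNetwork.map_permute {a b : ℕ} {f : (ι → Fin a → ℝ) → (ι → Fin b → ℝ)}
    (hf : IsEquivariantNetwork σ G f) {g : Perm ι} (hg : g ∈ G) (x : ι → Fin a → ℝ) :
    f (permute g x) = permute g (f x) := by
  induction hf with
  | single L hL => exact hL g hg x
  | cons f hf L hL ih =>
    simp only [ih]
    exact hL g hg fun i k => σ (f x i k)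

lemma map_permute_of_mem_invariantNetworks {c b : ℕ} {N : (ι → Fin c → ℝ) → (Fin b → ℝ)}
    (hN : N ∈ invariantNetworks σ G c b) {g : Perm ι} (hg : g ∈ G) (x : ι → Fin c → ℝ) :
    N (permute g x) = N x := by
  obtain ⟨p, q, f, h, m, hf, hh, -, hN⟩ := hN
  rw [hN, hN, hf.map_permute hg]
  congr 1
  funext l
  congr 1
  exact congrFun (hh g hg (fun i k => σ (f x i k))) l

lemma IsMLP.continuous (hσ : Continuous σ) {a b : ℕ} {M : (Fin a → ℝ) → (Fin b → ℝ)}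
    (hM : IsMLP σ M) : Continuous M := by
  induction hM with
  | single A => exact A.continuous_of_finiteDimensional
  | cons M hM A ih =>
    exact A.continuous_of_finiteDimensional.comp
      (continuous_pi fun k => hσ.comp ((continuous_apply k).comp ih))

lemma IsEquivariantNetwork.continuous [Finite ι] (hσ : Continuous σ) {a b : ℕ}
    {f : (ι → Fin a → ℝ) → (ι → Fin b → ℝ)} (hf : IsEquivariantNetwork σ G f) :
    Continuous f := by
  have := Fintype.ofFinite ι
  induction hf with
  | single L hL => exact L.continuous_of_finiteDimensional
  | cons f hf L hL ih =>
    exact L.continuous_of_finiteDimensional.comp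
      (continuous_pi fun i => continuous_pi fun k => hσ.comp
        ((continuous_apply k).comp ((continuous_apply i).comp ih)))

lemma continuous_of_mem_invariantNetworks [Finite ι] (hσ : Continuous σ) {c b : ℕ}
    {N : (ι → Fin c → ℝ) → (Fin b → ℝ)} (hN : N ∈ invariantNetworks σ G c b) :
    Continuous N := by
  have := Fintype.ofFinite ι
  obtain ⟨p, q, f, h, m, hf, -, hm, hN⟩ := hN
  rw [funext hN]
  refine (hm.continuous hσ).comp (continuous_pi fun l => hσ.comp ((continuous_apply l).comp
    (h.continuous_of_finiteDimensional.comp (continuous_pi fun i => continuous_pi fun k =>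
      hσ.comp ((continuous_apply k).comp ((continuous_apply i).comp (hf.continuous hσ)))))))

lemma continuous_oneChannel : Continuous (oneChannel : (ι → ℝ) → (ι → Fin 1 → ℝ)) :=
  continuous_pi fun i => continuous_pi fun _ => continuous_apply i

variable {n d : ℕ} {H : Subgroup (Perm (Fin d))}

lemma continuous_row (i : Fin n) : Continuous fun X : Fin n × Fin d → ℝ => row X i :=
  continuous_pi fun j => continuous_apply (i, j)

/-- DSS networks are invariant under the product group. -/
lemma eq_of_sameOrbit_of_mem_dssNetworks {b : ℕ} {F : (Fin n × Fin d → ℝ) → (Fin b → ℝ)}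
    (hF : F ∈ dssNetworks σ n H b) {X Y : Fin n × Fin d → ℝ}
    (hXY : SameOrbit (productGroup n H) X Y) : F X = F Y := by
  obtain ⟨N, hN, hF⟩ := hF
  obtain ⟨g, hg, rfl⟩ := hXY
  rw [hF, hF]
  exact (map_permute_of_mem_invariantNetworks hN hg (oneChannel X)).symm

/-- Sums over rows of `H`-invariant functions are invariant under the wreath product. -/
lemma sum_rows_eq_of_sameOrbit {E : Type*} [AddCommMonoid E] {φ : (Fin d → ℝ) → E}
    (hφ : ∀ g ∈ H, ∀ x, φ (permute g x) = φ x) {X Y : Fin n × Fin d → ℝ}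
    (hXY : SameOrbit (wreathGroup n H) X Y) : ∑ i, φ (row X i) = ∑ i, φ (row Y i) := by
  obtain ⟨g, ⟨q, h, hh, hg⟩, hXY⟩ := hXY
  refine Fintype.sum_equiv q _ _ fun i => ?_
  have : permute (h (q i)) (row X i) = row Y (q i) := permute_eq_iff.2 fun j => by
    have := permute_eq_iff.1 hXY (i, j)
    rwa [hg] at this
  rw [← this, hφ _ (hh _)]

/-- Siamese networks are invariant under the wreath product. -/
lemma eq_of_sameOrbit_of_mem_siameseNetworks {b : ℕ} {F : (Fin n × Fin d → ℝ) → (Fin b → ℝ)}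
    (hF : F ∈ siameseNetworks σ n H b) {X Y : Fin n × Fin d → ℝ}
    (hXY : SameOrbit (wreathGroup n H) X Y) : F X = F Y := by
  obtain ⟨a, φ, M, hφ, -, hF⟩ := hF
  rw [hF, hF]
  exact congrArg M (sum_rows_eq_of_sameOrbit (φ := fun x => φ (oneChannel x))
    (fun g hg x => map_permute_of_mem_invariantNetworks hφ hg (oneChannel x)) hXY)

end Networks

/-! ### Approximation by one hidden layer -/

section Approximation

open Topology Filter MeasureTheory

/-- The compact-open topology is that of uniform convergence on compact sets, so approximation
statements become statements about closures, where continuity of linear maps and of composition can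
be used. -/
lemma mem_closure_iff_forall_isCompact {X E : Type*} [TopologicalSpace X] [PseudoMetricSpace E]
    {A : Set C(X, E)} {f : C(X, E)} :
    f ∈ closure A ↔ ∀ K : Set X, IsCompact K → ∀ ε > 0, ∃ g ∈ A, ∀ x ∈ K, dist (g x) (f x) < ε := by
  rw [mem_closure_iff_nhds_basis
    (nhds_basis_uniformity Metric.uniformity_basis_dist.compactConvergenceUniformity)]
  constructor
  · intro h K hK ε hε
    obtain ⟨g, hg, h⟩ := h (K, ε) ⟨hK, hε⟩
    exact ⟨g, hg, h⟩
  · rintro h ⟨K, ε⟩ ⟨hK, hε⟩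
    obtain ⟨g, hg, h⟩ := h K hK ε hε
    exact ⟨g, hg, h⟩

/-- The map `t ↦ a t + b`. -/
def affineReal (a b : ℝ) : C(ℝ, ℝ) := ⟨fun t => a * t + b, by fun_prop⟩

/-- The closed span of the functions `t ↦ σ (a t + b)`. -/
def ridgeSpan (σ : C(ℝ, ℝ)) : Submodule ℝ C(ℝ, ℝ) :=
  (Submodule.span ℝ (Set.range fun p : ℝ × ℝ => σ.comp (affineReal p.1 p.2))).topologicalClosure

/-- Precomposition as a linear map. -/
def precompLinear {X Y : Type*} [TopologicalSpace X] [TopologicalSpace Y] (u : C(X, Y)) :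
    C(Y, ℝ) →ₗ[ℝ] C(X, ℝ) where
  toFun g := g.comp u
  map_add' _ _ := rfl
  map_smul' _ _ := rfl

/-- A continuous linear condition holds on the closed span if it holds for the generators. -/
lemma topologicalClosure_span_le_comap {E F : Type*} [AddCommGroup E] [Module ℝ E]
    [TopologicalSpace E] [IsTopologicalAddGroup E] [ContinuousConstSMul ℝ E]
    [AddCommGroup F] [Module ℝ F] [TopologicalSpace F] (T : E →ₗ[ℝ] F) (hT : Continuous T)
    {s : Set E} {P : Submodule ℝ F} (hP : IsClosed (P : Set F)) (h : ∀ x ∈ s, T x ∈ P) :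
    (Submodule.span ℝ s).topologicalClosure ≤ P.comap T :=
  Submodule.topologicalClosure_minimal _ (Submodule.span_le.2 h) (hP.preimage hT)

variable {σ : C(ℝ, ℝ)}

lemma isClosed_ridgeSpan : IsClosed (ridgeSpan σ : Set C(ℝ, ℝ)) :=
  Submodule.isClosed_topologicalClosure _

lemma comp_affineReal_mem_ridgeSpan {f : C(ℝ, ℝ)} (hf : f ∈ ridgeSpan σ) (a b : ℝ) :
    f.comp (affineReal a b) ∈ ridgeSpan σ := by
  refine topologicalClosure_span_le_comap (precompLinear (affineReal a b))
    (ContinuousMap.continuous_precomp _) isClosed_ridgeSpan ?_ hf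
  rintro _ ⟨p, rfl⟩
  refine Submodule.le_topologicalClosure _ (Submodule.subset_span ⟨(p.1 * a, p.1 * b + p.2), ?_⟩)
  ext t
  simp only [precompLinear, affineReal, LinearMap.coe_mk, AddHom.coe_mk, ContinuousMap.comp_apply,
    ContinuousMap.coe_mk]
  congr 1
  ring

lemma self_mem_ridgeSpan : σ ∈ ridgeSpan σ := by
  refine Submodule.le_topologicalClosure _ (Submodule.subset_span ⟨(1, 0), ?_⟩)
  ext t
  simp [affineReal]

/-- The average of `f` over `[t, t + 1]`. -/
noncomputable def average (f : C(ℝ, ℝ)) : C(ℝ, ℝ) :=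
  ⟨fun t => ∫ x in t..t + 1, f x, by
    have h : Continuous fun t => ∫ x in (0 : ℝ)..t, f x :=
      intervalIntegral.continuous_primitive (fun a b => f.continuous.intervalIntegrable a b) 0
    have : (fun t => ∫ x in t..t + 1, f x) =
        fun t => (∫ x in (0 : ℝ)..t + 1, f x) - ∫ x in (0 : ℝ)..t, f x := by
      funext t
      rw [intervalIntegral.integral_interval_sub_left] <;>
        exact f.continuous.intervalIntegrable _ _
    rw [this]
    exact (h.comp (continuous_add_const 1)).sub h⟩

lemma hasDerivAt_average (f : C(ℝ, ℝ)) (t : ℝ) :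
    HasDerivAt (average f) (f (t + 1) - f t) t := by
  have h : ∀ t, HasDerivAt (fun t => ∫ x in (0 : ℝ)..t, f x) (f t) t := fun t =>
    intervalIntegral.integral_hasDerivAt_right (f.continuous.intervalIntegrable _ _)
      (f.continuous.stronglyMeasurableAtFilter _ _) f.continuous.continuousAt
  have : (average f : ℝ → ℝ) =
      fun t => (∫ x in (0 : ℝ)..t + 1, f x) - ∫ x in (0 : ℝ)..t, f x := by
    funext t
    rw [intervalIntegral.integral_interval_sub_left]
    · rfl
    all_goals exact f.continuous.intervalIntegrable _ _
  rw [this]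
  exact ((h (t + 1)).comp_add_const t 1).sub (h t)

/-- The average is the integral of the translates of `f` over a probability measure. On a compact
`K` this is a Bochner integral in `C(K, ℝ)`, and it stays in any closed convex set that contains the
translates. -/
lemma average_mem_ridgeSpan {f : C(ℝ, ℝ)} (hf : f ∈ ridgeSpan σ) :
    average f ∈ ridgeSpan σ := by
  have hcl : closure (ridgeSpan σ : Set C(ℝ, ℝ)) = ridgeSpan σ := isClosed_ridgeSpan.closure_eq
  rw [← SetLike.mem_coe, ← hcl, mem_closure_iff_forall_isCompact]
  intro K hK ε hε
  have : CompactSpace K := isCompact_iff_compactSpace.1 hK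
  let ρ : C(ℝ, ℝ) →ₗ[ℝ] C(K, ℝ) := precompLinear ⟨Subtype.val, continuous_subtype_val⟩
  let μ : Measure ℝ := volume.restrict (Set.Ioc 0 1)
  have : IsProbabilityMeasure μ := ⟨by simp [μ]⟩
  let Φ : C(ℝ, C(K, ℝ)) :=
    ContinuousMap.curry ⟨fun p : ℝ × K => f (p.2 + p.1), by fun_prop⟩
  have hint : Integrable Φ μ := (Φ.continuous.integrableOn_Ioc (a := 0) (b := 1))
  have hmem : (∫ x, Φ x ∂μ) ∈ closure ((ridgeSpan σ).map ρ : Set C(K, ℝ)) := by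
    refine Convex.integral_mem ((Submodule.convex _).closure) isClosed_closure
      (ae_of_all _ fun x => subset_closure ?_) hint
    refine ⟨_, comp_affineReal_mem_ridgeSpan hf 1 x, ?_⟩
    ext y
    simp [ρ, Φ, precompLinear, affineReal]
  obtain ⟨_, ⟨g, hg, rfl⟩, hd⟩ := Metric.mem_closure_iff.1 hmem ε hε
  refine ⟨g, hg, fun x hx => ?_⟩
  have h1 := (ContinuousMap.dist_lt_iff hε).1 hd ⟨x, hx⟩
  rw [ContinuousMap.integral_apply hint, dist_comm] at h1
  convert h1 using 1
  congr 1
  change ∫ y in x..x + 1, f y = ∫ y in Set.Ioc 0 1, f (x + y)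
  rw [← intervalIntegral.integral_of_le zero_le_one, intervalIntegral.integral_comp_add_left]
  simp

/-- If every second difference vanished, `σ` would preserve midpoints, and a continuous map that
does so is affine. -/
lemma exists_secondDifference_ne_zero {σ : ℝ → ℝ} (hσ : Continuous σ)
    (hna : ¬ ∃ α β : ℝ, ∀ t, σ t = α * t + β) :
    ∃ a b, σ (a * 2 + b) - 2 * σ (a * 1 + b) + σ (a * 0 + b) ≠ 0 := by
  by_contra! hc
  have hmid : ∀ x y, σ (midpoint ℝ x y) = midpoint ℝ (σ x) (σ y) := by
    intro x y
    have := hc ((y - x) / 2) x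
    rw [show (y - x) / 2 * 2 + x = y by ring, show (y - x) / 2 * 1 + x = (x + y) / 2 by ring,
      show (y - x) / 2 * 0 + x = x by ring] at this
    rw [midpoint_eq_smul_add, midpoint_eq_smul_add, smul_eq_mul, smul_eq_mul,
      show (⅟2 : ℝ) * (x + y) = (x + y) / 2 by rw [invOf_eq_inv]; ring]
    rw [invOf_eq_inv]
    linarith
  let A := AffineMap.ofMapMidpoint σ hmid hσ
  refine hna ⟨A.linear 1, A 0, fun t => ?_⟩
  have h := congrFun A.decomp t
  have h2 : A.linear t = A.linear 1 * t := by
    have := A.linear.map_smul t 1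
    simpa [mul_comm] using this
  calc σ t = A t := rfl
    _ = A.linear t + A 0 := h
    _ = _ := by rw [h2]

/-- The square function. -/
def sqMap : C(ℝ, ℝ) := ⟨fun t => t ^ 2, by fun_prop⟩

/-- Averaging twice makes `f` twice differentiable without leaving the closed span, and the second
derivative of the result at 0 is a second difference of `f`, chosen nonzero. The symmetric second
difference of `s` at scale `r`, divided by `c * r ^ 2`, then tends to `t ^ 2` uniformly on compact
sets as `r` tends to 0. -/
lemma sqMap_mem_ridgeSpan (hna : ¬ ∃ α β : ℝ, ∀ t, σ t = α * t + β) :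
    sqMap ∈ ridgeSpan σ := by
  obtain ⟨a, b, hab⟩ := exists_secondDifference_ne_zero σ.continuous hna
  set f := σ.comp (affineReal a b) with hf
  have hfm : f ∈ ridgeSpan σ := comp_affineReal_mem_ridgeSpan self_mem_ridgeSpan a b
  -- This is the value at 0 of the second derivative of the double average `s`.
  set c := f 2 - 2 * f 1 + f 0 with hc
  have hc0 : c ≠ 0 := hab
  set s := average (average f) with hs
  have hsm : s ∈ ridgeSpan σ := average_mem_ridgeSpan (average_mem_ridgeSpan hfm)
  have hs1 : ∀ t, HasDerivAt s (average f (t + 1) - average f t) t := hasDerivAt_average _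
  -- the symmetric second difference of `s` at the origin
  have hR : (fun u => s u + s (-u) - 2 * s 0 - c * u ^ 2) =o[𝓝 0] fun u : ℝ => u ^ 2 := by
    have hg : ∀ t, HasDerivAt (average f) (f (t + 1) - f t) t := hasDerivAt_average f
    have hs2 : HasDerivAt (fun u => average f (u + 1) - average f u) c 0 := by
      refine (((hg (0 + 1)).comp_add_const 0 1).sub (hg 0)).congr_deriv ?_
      rw [hc]
      norm_num
      ring
    have hs2' : HasDerivAt (fun u => average f (-u + 1) - average f (-u)) (-c) 0 := by
      have h0 : HasDerivAt (fun u => average f (u + 1) - average f u) c (-0) := by simpa using hs2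
      exact (h0.scomp (0 : ℝ) (hasDerivAt_neg 0)).congr_deriv (by simp)
    have h := ((hs2.sub hs2').isLittleO)
    have h1 : ∀ u, HasDerivAt (fun u => s u + s (-u) - 2 * s 0 - c * u ^ 2)
        (average f (u + 1) - average f u - (average f (-u + 1) - average f (-u)) - 2 * c * u) u := by
      intro u
      refine ((((hs1 u).add ((hs1 (-u)).scomp u (hasDerivAt_neg u))).sub_const (2 * s 0)).sub
        ((hasDerivAt_pow 2 u).const_mul c)).congr_deriv ?_
      simp
      ring
    have h2 := convex_univ.isLittleO_pow_succ_real (x₀ := 0) (n := 1) (Set.mem_univ _)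
      (fun u _ => (h1 u).hasDerivWithinAt) (by
        simp only [nhdsWithin_univ, pow_one]
        refine h.congr_left fun u => ?_
        simp
        ring)
    simp only [nhdsWithin_univ, sub_zero] at h2
    refine h2.congr_left fun u => ?_
    simp
    ring
  have hcl : closure (ridgeSpan σ : Set C(ℝ, ℝ)) = ridgeSpan σ := isClosed_ridgeSpan.closure_eq
  rw [← SetLike.mem_coe, ← hcl, mem_closure_iff_forall_isCompact]
  intro K hK ε hε
  obtain ⟨R, hR0, hKR⟩ := hK.isBounded.exists_pos_norm_le
  have hη : 0 < ε * |c| / (2 * R ^ 2) := by positivity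
  obtain ⟨δ, hδ, hball⟩ := Metric.eventually_nhds_iff.1 (hR.def hη)
  -- For `|t| ≤ R` the point `r * t` then lies within `δ / 2` of 0, where the little-o bound
  -- applies.
  set r := δ / (2 * R) with hr
  have hr0 : 0 < r := by positivity
  refine ⟨(c * r ^ 2)⁻¹ • (s.comp (affineReal r 0) + s.comp (affineReal (-r) 0) -
    (2 : ℝ) • s.comp (affineReal 0 0)), ?_, fun t ht => ?_⟩
  · exact Submodule.smul_mem _ _ (Submodule.sub_mem _ (Submodule.add_mem _
      (comp_affineReal_mem_ridgeSpan hsm _ _) (comp_affineReal_mem_ridgeSpan hsm _ _))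
      (Submodule.smul_mem _ _ (comp_affineReal_mem_ridgeSpan hsm _ _)))
  · have htR : |t| ≤ R := hKR t ht
    have h1 := hball (y := r * t) (by
      rw [dist_zero_right, Real.norm_eq_abs, abs_mul, abs_of_pos hr0]
      calc r * |t| ≤ r * R := by gcongr
        _ = δ / 2 := by rw [hr]; field_simp
        _ < δ := half_lt_self hδ)
    set D := s (r * t) + s (-(r * t)) - 2 * s 0 with hD
    have h2 : ((c * r ^ 2)⁻¹ • (s.comp (affineReal r 0) + s.comp (affineReal (-r) 0) -
        (2 : ℝ) • s.comp (affineReal 0 0)) : C(ℝ, ℝ)) t = (c * r ^ 2)⁻¹ * D := by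
      simp [affineReal, hD]
    have h3 : (c * r ^ 2)⁻¹ * D - t ^ 2 = (c * r ^ 2)⁻¹ * (D - c * (r * t) ^ 2) := by
      field_simp
    rw [h2, Real.dist_eq, show sqMap t = t ^ 2 from rfl, h3, abs_mul, abs_inv, abs_mul]
    rw [Real.norm_eq_abs, Real.norm_eq_abs] at h1
    have hcp : 0 < |c| := abs_pos.2 hc0
    have ht2 : t ^ 2 ≤ R ^ 2 := by
      rw [← sq_abs]
      gcongr
    calc (|c| * |r ^ 2|)⁻¹ * |D - c * (r * t) ^ 2|
        ≤ (|c| * |r ^ 2|)⁻¹ * (ε * |c| / (2 * R ^ 2) * |(r * t) ^ 2|) := by gcongr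
      _ = ε / 2 * (t ^ 2 / R ^ 2) := by
        rw [abs_of_pos (show 0 < r ^ 2 by positivity), abs_of_nonneg (sq_nonneg (r * t))]
        field_simp
      _ ≤ ε / 2 * 1 := by
        gcongr
        exact div_le_one_of_le₀ ht2 (by positivity)
      _ < ε := by linarith

/-- `t = ((t + 1) ^ 2 - (t - 1) ^ 2) / 4`. -/
lemma id_mem_ridgeSpan (hna : ¬ ∃ α β : ℝ, ∀ t, σ t = α * t + β) :
    ContinuousMap.id ℝ ∈ ridgeSpan σ := by
  have h := sqMap_mem_ridgeSpan hna
  convert Submodule.smul_mem _ (1 / 4 : ℝ) (Submodule.sub_mem _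
    (comp_affineReal_mem_ridgeSpan h 1 1) (comp_affineReal_mem_ridgeSpan h 1 (-1)))
  ext t
  simp [affineReal, sqMap]
  ring

end Approximation

/-! ### Universality of multilayer perceptrons -/

section Perceptrons

lemma IsMLP.affine_comp {σ : ℝ → ℝ} {a b c : ℕ} {M : (Fin a → ℝ) → (Fin b → ℝ)}
    (hM : IsMLP σ M) (A : (Fin b → ℝ) →ᵃ[ℝ] (Fin c → ℝ)) : IsMLP σ fun v => A (M v) := by
  cases hM with
  | single B => exact .single (A.comp B)
  | cons M hM B => exact .cons M hM (A.comp B)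

lemma IsMLP.comp {σ : ℝ → ℝ} {a b c : ℕ} {M' : (Fin b → ℝ) → (Fin c → ℝ)}
    {M : (Fin a → ℝ) → (Fin b → ℝ)} (hM' : IsMLP σ M') (hM : IsMLP σ M) :
    IsMLP σ fun v => M' (M v) := by
  induction hM' with
  | single A => exact hM.affine_comp A
  | cons M' _ A ih => exact .cons _ ih A

/-- Multilayer perceptrons as continuous maps. -/
def mlpSet (σ : C(ℝ, ℝ)) (a b : ℕ) : Set C(Fin a → ℝ, Fin b → ℝ) := {M | IsMLP σ M}

/-- Multilayer perceptrons with one hidden layer, as continuous maps. -/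
def oneHiddenSet (σ : C(ℝ, ℝ)) (a b : ℕ) : Set C(Fin a → ℝ, Fin b → ℝ) :=
  {M | ∃ (r : ℕ) (B : (Fin a → ℝ) →ᵃ[ℝ] (Fin r → ℝ)) (A : (Fin r → ℝ) →ᵃ[ℝ] (Fin b → ℝ)),
    ∀ v, M v = A fun k => σ (B v k)}

variable {σ : C(ℝ, ℝ)} {a b c : ℕ}

lemma oneHiddenSet_subset_mlpSet : oneHiddenSet σ a b ⊆ mlpSet σ a b := by
  rintro M ⟨r, B, A, hM⟩
  rw [mlpSet, Set.mem_ofPred_eq, funext hM]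
  exact .cons _ (.single B) A

/-- Composition is jointly continuous in the compact-open topology here, so limits of perceptrons
may be stacked like perceptrons. -/
lemma comp_mem_closure_mlpSet {M' : C(Fin b → ℝ, Fin c → ℝ)} {M : C(Fin a → ℝ, Fin b → ℝ)}
    (hM' : M' ∈ closure (mlpSet σ b c)) (hM : M ∈ closure (mlpSet σ a b)) :
    M'.comp M ∈ closure (mlpSet σ a c) :=
  map_mem_closure₂ (f := fun M M' => ContinuousMap.comp M' M) ContinuousMap.continuous_comp' hM hM'
    fun M h M' h' => IsMLP.comp (M' := M') (M := M) h' h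

lemma mem_closure_mlpSet_of_affine {M : C(Fin a → ℝ, Fin b → ℝ)}
    (A : (Fin a → ℝ) →ᵃ[ℝ] (Fin b → ℝ)) (hM : ∀ v, M v = A v) : M ∈ closure (mlpSet σ a b) := by
  refine subset_closure ?_
  rw [mlpSet, Set.mem_ofPred_eq, funext hM]
  exact .single A

/-- The map `v ↦ g (ℓ v) • w`, as a linear function of `g`. -/
def ridgeMap (ℓ : (Fin a → ℝ) →ᵃ[ℝ] ℝ) (w : Fin b → ℝ) :
    C(ℝ, ℝ) →ₗ[ℝ] C(Fin a → ℝ, Fin b → ℝ) where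
  toFun g := ⟨fun v => g (ℓ v) • w,
    (g.continuous.comp ℓ.continuous_of_finiteDimensional).smul continuous_const⟩
  map_add' g g' := by ext; simp [add_mul]
  map_smul' r g := by ext; simp [mul_assoc]

@[simp] lemma ridgeMap_apply (ℓ : (Fin a → ℝ) →ᵃ[ℝ] ℝ) (w : Fin b → ℝ) (g : C(ℝ, ℝ))
    (v : Fin a → ℝ) : ridgeMap ℓ w g v = g (ℓ v) • w := rfl

lemma continuous_ridgeMap (ℓ : (Fin a → ℝ) →ᵃ[ℝ] ℝ) (w : Fin b → ℝ) :
    Continuous (ridgeMap ℓ w) :=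
  (ContinuousMap.continuous_postcomp (⟨fun t => t • w, by fun_prop⟩ : C(ℝ, Fin b → ℝ))).comp
    (ContinuousMap.continuous_precomp
      (⟨ℓ, ℓ.continuous_of_finiteDimensional⟩ : C(Fin a → ℝ, ℝ)))

/-- The closed span of the maps `v ↦ σ (ℓ v) • w`. -/
def ridgeMapSpan (σ : C(ℝ, ℝ)) (a b : ℕ) : Submodule ℝ C(Fin a → ℝ, Fin b → ℝ) :=
  (Submodule.span ℝ (Set.range fun p : ((Fin a → ℝ) →ᵃ[ℝ] ℝ) × (Fin b → ℝ) =>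
    ridgeMap p.1 p.2 σ)).topologicalClosure

lemma ridgeMap_mem_ridgeMapSpan (ℓ : (Fin a → ℝ) →ᵃ[ℝ] ℝ) (w : Fin b → ℝ) {g : C(ℝ, ℝ)}
    (hg : g ∈ ridgeSpan σ) : ridgeMap ℓ w g ∈ ridgeMapSpan σ a b := by
  refine topologicalClosure_span_le_comap (ridgeMap ℓ w) (continuous_ridgeMap ℓ w)
    (Submodule.isClosed_topologicalClosure _) ?_ hg
  rintro _ ⟨p, rfl⟩
  refine Submodule.le_topologicalClosure _ (Submodule.subset_span
    ⟨(p.1 • ℓ + AffineMap.const ℝ _ p.2, w), ?_⟩)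
  ext v
  simp [affineReal]

/-- A finite combination of maps `v ↦ σ (ℓ v) • w` is literally a network with one hidden layer: the
`ℓ` form its first affine map, the weighted `w` its second. -/
lemma ridgeMapSpan_subset_closure :
    (ridgeMapSpan σ a b : Set C(Fin a → ℝ, Fin b → ℝ)) ⊆ closure (oneHiddenSet σ a b) := by
  refine closure_mono fun M hM => ?_
  obtain ⟨r, f, g, rfl⟩ := Submodule.mem_span_set'.1 hM
  choose p hp using fun i => (g i).2
  refine ⟨r, AffineMap.pi fun i => (p i).1,
    (Fintype.linearCombination ℝ fun i => f i • (p i).2).toAffineMap, fun v => ?_⟩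
  simp only [← hp, ContinuousMap.coe_sum, Finset.sum_apply, ContinuousMap.coe_smul, Pi.smul_apply,
    ridgeMap_apply, LinearMap.coe_toAffineMap, Fintype.linearCombination_apply, AffineMap.pi_apply]
  exact Finset.sum_congr rfl fun i _ => smul_comm _ _ _

lemma id_mem_closure_oneHiddenSet (hna : ¬ ∃ α β : ℝ, ∀ t, σ t = α * t + β) :
    ContinuousMap.id (Fin a → ℝ) ∈ closure (oneHiddenSet σ a a) := by
  refine ridgeMapSpan_subset_closure ?_
  have h := Submodule.sum_mem (ridgeMapSpan σ a a) fun i (_ : i ∈ Finset.univ) =>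
    ridgeMap_mem_ridgeMapSpan (LinearMap.proj i : (Fin a → ℝ) →ₗ[ℝ] ℝ).toAffineMap
      (Pi.single i 1) (id_mem_ridgeSpan hna)
  refine (congrArg (· ∈ ridgeMapSpan σ a a) ?_).mpr h
  ext v j
  simp [Finset.sum_apply, Pi.single_apply]

/-- The map that appends the product of two affine functions to its input is approximable. -/
lemma exists_mem_closure_append_mul (hna : ¬ ∃ α β : ℝ, ∀ t, σ t = α * t + β)
    (C D : (Fin a → ℝ) →ᵃ[ℝ] ℝ) : ∃ F ∈ closure (mlpSet σ a (a + 1)),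
      ∀ v, F v = Fin.cons (C v * D v) v := by
  have hsq := sqMap_mem_ridgeSpan hna
  -- Polarization, `C * D = ((C + D) ^ 2 - (C - D) ^ 2) / 4`, fills entry 0. The remaining summands
  -- copy the input.
  refine ⟨_, closure_mono oneHiddenSet_subset_mlpSet (ridgeMapSpan_subset_closure
    (Submodule.add_mem _ (Submodule.sub_mem _
      (ridgeMap_mem_ridgeMapSpan (C + D) (Pi.single 0 (1 / 4)) hsq)
      (ridgeMap_mem_ridgeMapSpan (C - D) (Pi.single 0 (1 / 4)) hsq))
    (Submodule.sum_mem (ridgeMapSpan σ a (a + 1)) fun i (_ : i ∈ Finset.univ) =>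
    ridgeMap_mem_ridgeMapSpan (LinearMap.proj i : (Fin a → ℝ) →ₗ[ℝ] ℝ).toAffineMap
      (Pi.single i.succ 1) (id_mem_ridgeSpan hna)))), fun v => ?_⟩
  funext j
  refine Fin.cases ?_ (fun j => ?_) j
  · simp [sqMap, Finset.sum_apply, Fin.succ_ne_zero, eq_comm]
    ring
  · simp [Finset.sum_apply, Pi.single_apply]

/-- `p` is an affine function of `u`. -/
def IsAffineFunctionOf {E : Type*} [AddCommGroup E] [Module ℝ E] (p : (Fin a → ℝ) → E)
    (u : (Fin a → ℝ) → (Fin b → ℝ)) : Prop :=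
  ∃ B : (Fin b → ℝ) →ᵃ[ℝ] E, ∀ v, p v = B (u v)

lemma IsAffineFunctionOf.trans {E : Type*} [AddCommGroup E] [Module ℝ E]
    {p : (Fin a → ℝ) → E} {u : (Fin a → ℝ) → (Fin b → ℝ)} {w : (Fin a → ℝ) → (Fin c → ℝ)}
    (hp : IsAffineFunctionOf p u) (hu : IsAffineFunctionOf u w) : IsAffineFunctionOf p w := by
  obtain ⟨B, hB⟩ := hp
  obtain ⟨C, hC⟩ := hu
  exact ⟨B.comp C, fun v => by rw [hB, hC]; rfl⟩

lemma IsAffineFunctionOf.refl (u : (Fin a → ℝ) → (Fin b → ℝ)) : IsAffineFunctionOf u u :=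
  ⟨AffineMap.id ℝ _, fun _ => rfl⟩

/-- Functions that can be computed, up to arbitrarily small errors, by further layers of any
network that keeps its input. -/
def IsComputable (σ : C(ℝ, ℝ)) {a : ℕ} (p : C(Fin a → ℝ, ℝ)) : Prop :=
  ∀ (k : ℕ), ∀ u ∈ closure (mlpSet σ a k), IsAffineFunctionOf id u →
    ∃ (r : ℕ), ∃ u' ∈ closure (mlpSet σ a r), IsAffineFunctionOf u u' ∧ IsAffineFunctionOf p u'

lemma isComputable_affine (A : (Fin a → ℝ) →ᵃ[ℝ] ℝ) {p : C(Fin a → ℝ, ℝ)}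
    (hp : ∀ v, p v = A v) : IsComputable σ p := fun k u hu hid =>
  ⟨k, u, hu, .refl u, IsAffineFunctionOf.trans ⟨A, hp⟩ hid⟩

/-- The algebra of computable functions. -/
def computableAlgebra (hna : ¬ ∃ α β : ℝ, ∀ t, σ t = α * t + β) (a : ℕ) :
    Subalgebra ℝ C(Fin a → ℝ, ℝ) where
  carrier := {p | IsComputable σ p}
  add_mem' := by
    intro p q hp hq k u hu hid
    obtain ⟨r, u₁, hu₁, huu₁, hpu₁⟩ := hp k u hu hid
    obtain ⟨s, u₂, hu₂, huu₂, B, hB⟩ := hq r u₁ hu₁ (hid.trans huu₁)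
    obtain ⟨C, hC⟩ := hpu₁.trans huu₂
    exact ⟨s, u₂, hu₂, huu₁.trans huu₂, C + B, fun v => by simp [hB, hC]⟩
  mul_mem' := by
    intro p q hp hq k u hu hid
    obtain ⟨r, u₁, hu₁, huu₁, hpu₁⟩ := hp k u hu hid
    -- Computing `q` on top of `u₁` keeps `p` available, so that `u₂` carries both factors.
    obtain ⟨s, u₂, hu₂, huu₂, B, hB⟩ := hq r u₁ hu₁ (hid.trans huu₁)
    obtain ⟨C, hC⟩ := hpu₁.trans huu₂
    obtain ⟨F, hF, hFv⟩ := exists_mem_closure_append_mul hna C B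
    have h : IsAffineFunctionOf u₂ (F.comp u₂) :=
      ⟨(LinearMap.funLeft ℝ ℝ Fin.succ).toAffineMap, fun v => by
        funext i
        simp [hFv, LinearMap.funLeft_apply]⟩
    exact ⟨s + 1, F.comp u₂, comp_mem_closure_mlpSet hF hu₂, (huu₁.trans huu₂).trans h,
      (LinearMap.proj 0 : (Fin (s + 1) → ℝ) →ₗ[ℝ] ℝ).toAffineMap, fun v => by
        simp [hFv, hB, hC]⟩
  algebraMap_mem' r := isComputable_affine (AffineMap.const ℝ _ r) fun v => by simp

lemma separatesPoints_computableAlgebra (hna : ¬ ∃ α β : ℝ, ∀ t, σ t = α * t + β) :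
    (computableAlgebra hna a).SeparatesPoints := by
  intro x y hxy
  obtain ⟨i, hi⟩ := Function.ne_iff.1 hxy
  exact ⟨_, ⟨⟨fun v => v i, continuous_apply i⟩, isComputable_affine
    (LinearMap.proj i : (Fin a → ℝ) →ₗ[ℝ] ℝ).toAffineMap fun v => rfl, rfl⟩, hi⟩

/-- Finitely many computable functions are the entries of an approximable map. -/
lemma pi_mem_closure_mlpSet {p : Fin b → C(Fin a → ℝ, ℝ)} (hp : ∀ l, IsComputable σ (p l)) :
    ContinuousMap.pi p ∈ closure (mlpSet σ a b) := by
  have key : ∀ s : Finset (Fin b), ∃ k, ∃ u ∈ closure (mlpSet σ a k),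
      IsAffineFunctionOf id u ∧ ∀ l ∈ s, IsAffineFunctionOf (p l) u := by
    intro s
    induction s using Finset.induction_on with
    | empty => exact ⟨a, .id _, mem_closure_mlpSet_of_affine (AffineMap.id ℝ _) fun _ => rfl,
        .refl _, by simp⟩
    | insert l s _ ih =>
      obtain ⟨k, u, hu, hid, hs⟩ := ih
      obtain ⟨r, u', hu', huu', hl⟩ := hp l k u hu hid
      refine ⟨r, u', hu', hid.trans huu', fun i hi => ?_⟩
      obtain rfl | hi := Finset.mem_insert.1 hi
      exacts [hl, (hs i hi).trans huu']
  obtain ⟨k, u, hu, -, h⟩ := key Finset.univ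
  choose B hB using fun l => h l (Finset.mem_univ l)
  let A : C(Fin k → ℝ, Fin b → ℝ) := ⟨AffineMap.pi B, AffineMap.continuous_of_finiteDimensional _⟩
  have : ContinuousMap.pi p = A.comp u := by
    ext v l
    exact hB l v
  rw [this]
  exact comp_mem_closure_mlpSet (mem_closure_mlpSet_of_affine (AffineMap.pi B) fun _ => rfl) hu

/-- Multilayer perceptrons are universal, for every continuous activation that is not affine. -/
theorem closure_mlpSet_eq_univ (hna : ¬ ∃ α β : ℝ, ∀ t, σ t = α * t + β) :
    closure (mlpSet σ a b) = Set.univ := by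
  refine Set.eq_univ_of_forall fun f => ?_
  rw [← closure_closure, mem_closure_iff_forall_isCompact]
  intro K hK ε hε
  choose p hp hpf using fun l =>
    ContinuousMap.exists_mem_subalgebra_near_continuous_of_isCompact_of_separatesPoints
      (separatesPoints_computableAlgebra hna) ⟨fun v => f v l, by fun_prop⟩ hK hε
  exact ⟨_, pi_mem_closure_mlpSet hp, fun x hx => (dist_pi_lt_iff hε).2 fun l => by
    simpa [dist_eq_norm] using hpf l x hx⟩

/-- Universality of multilayer perceptrons, on a compact set. -/
theorem exists_isMLP_near (hna : ¬ ∃ α β : ℝ, ∀ t, σ t = α * t + β)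
    (f : C(Fin a → ℝ, Fin b → ℝ)) {K : Set (Fin a → ℝ)} (hK : IsCompact K) {ε : ℝ} (hε : 0 < ε) :
    ∃ M, IsMLP σ M ∧ ∀ v ∈ K, dist (M v) (f v) < ε := by
  have hf : f ∈ closure (mlpSet σ a b) := closure_mlpSet_eq_univ hna ▸ Set.mem_univ f
  obtain ⟨M, hM, h⟩ := mem_closure_iff_forall_isCompact.1 hf K hK ε hε
  exact ⟨M, hM, h⟩

end Perceptrons

/-! ### Universality of Siamese networks -/

section Siamese

variable {n d : ℕ} {H : Subgroup (Perm (Fin d))}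

/-- A continuous invariant function that vanishes at the given points outside the orbit of `w`, but
not at `w`. -/
lemma exists_invariant_bump {V : Type*} [MetricSpace V] (H : Subgroup (Perm (Fin d)))
    {ι : Type*} [Finite ι] (z : ι → Fin d → V) (w : Fin d → V) :
    ∃ ψ : (Fin d → V) → ℝ, Continuous ψ ∧ (∀ g ∈ H, ∀ x, ψ (permute g x) = ψ x) ∧ ψ w ≠ 0 ∧
      ∀ i, ¬ SameOrbit H w (z i) → ψ (z i) = 0 := by
  classical
  have := Fintype.ofFinite H
  have := Fintype.ofFinite ι
  -- Each factor multiplies the distances from the translates of `v` to `z i`, and so vanishes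
  -- exactly on the orbit of `z i`. The orbit of `w` is left out.
  refine ⟨fun v => ∏ i, if SameOrbit H w (z i) then 1 else ∏ h : H, dist (permute h.1 v) (z i),
    continuous_finsetProd _ fun i _ => ?_, fun g hg x => ?_, ?_, fun i hi => ?_⟩
  · split_ifs
    · exact continuous_const
    · exact continuous_finsetProd _ fun h _ => (continuous_permute h.1).dist continuous_const
  · refine Finset.prod_congr rfl fun i _ => ?_
    congr 1
    refine Fintype.prod_equiv (Equiv.mulRight ⟨g, hg⟩) _ _ fun h => ?_
    simp [permute_mul]
  · refine Finset.prod_ne_zero_iff.2 fun i _ => ?_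
    split_ifs with hi
    · exact one_ne_zero
    · exact Finset.prod_ne_zero_iff.2 fun h _ => dist_ne_zero.2 fun heq => hi ⟨h, h.2, heq⟩
  · refine Finset.prod_eq_zero (Finset.mem_univ i) ?_
    rw [if_neg hi]
    exact Finset.prod_eq_zero (Finset.mem_univ 1) (by simp)

/-- Sums of continuous invariant functions determine a finite family up to the order of its members
and their orbits. -/
lemma exists_perm_sameOrbit {V : Type*} [MetricSpace V] {x y : Fin n → Fin d → V}
    (hxy : ∀ ψ : (Fin d → V) → ℝ, Continuous ψ → (∀ g ∈ H, ∀ v, ψ (permute g v) = ψ v) →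
      ∑ i, ψ (x i) = ∑ i, ψ (y i)) :
    ∃ q : Perm (Fin n), ∀ i, SameOrbit H (x i) (y (q i)) := by
  classical
  let r : (Fin d → V) → Quotient (orbitSetoid H V) := Quotient.mk _
  have hr : ∀ v w, r v = r w ↔ SameOrbit H v w := fun v w => Quotient.eq
  -- For each orbit a bump function that kills all the other orbits present turns the equality of
  -- sums into an equality of multiplicities.
  have hcard : ∀ o, Fintype.card {i // r (x i) = o} = Fintype.card {i // r (y i) = o} := by
    intro o
    obtain ⟨w, rfl⟩ := Quotient.exists_rep o
    obtain ⟨ψ, hψ, hinv, hw, hz⟩ := exists_invariant_bump H (Sum.elim x y) w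
    have hsum : ∀ v : Fin n → Fin d → V, (∀ i, ¬ SameOrbit H w (v i) → ψ (v i) = 0) →
        ∑ i, ψ (v i) = Fintype.card {i // r (v i) = r w} * ψ w := by
      intro v hv
      have : ∀ i, ψ (v i) = if r (v i) = r w then ψ w else 0 := by
        intro i
        split_ifs with h
        · obtain ⟨g, hg, h⟩ := (hr _ _).1 h
          rw [← h, hinv g hg]
        · exact hv i fun h' => h ((hr _ _).2 h'.symm)
      rw [Finset.sum_congr rfl fun i _ => this i, ← Finset.sum_filter, Finset.sum_const,
        nsmul_eq_mul, Fintype.card_subtype]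
    have h := hxy ψ hψ hinv
    rw [hsum x fun i => hz (Sum.inl i), hsum y fun i => hz (Sum.inr i)] at h
    exact_mod_cast mul_right_cancel₀ hw h
  let e : ∀ o, {i // r (x i) = o} ≃ {i // r (y i) = o} :=
    fun o => Fintype.equivOfCardEq (hcard o)
  exact ⟨Equiv.ofFiberEquiv (f := fun i => r (x i)) (g := fun i => r (y i)) e, fun i =>
    (hr _ _).1 (Equiv.ofFiberEquiv_map (f := fun i => r (x i)) (g := fun i => r (y i)) e i).symm⟩

/-- Continuous functions of finitely many sums `∑ i, ψ (x_i)` with continuous invariant `ψ`. -/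
def rowSumAlgebra (n : ℕ) (H : Subgroup (Perm (Fin d))) :
    Subalgebra ℝ C(Fin n × Fin d → ℝ, ℝ) where
  carrier := {F | ∃ (ι : Type) (_ : Fintype ι) (ψ : C(Fin d → ℝ, ι → ℝ)) (M : C(ι → ℝ, ℝ)),
    (∀ g ∈ H, ∀ x, ψ (permute g x) = ψ x) ∧ ∀ X, F X = M (∑ i, ψ (row X i))}
  add_mem' := by
    rintro F F' ⟨ι, _, ψ, M, hψ, hF⟩ ⟨ι', _, ψ', M', hψ', hF'⟩
    refine ⟨ι ⊕ ι', inferInstance, ⟨fun v => Sum.elim (ψ v) (ψ' v), ?_⟩,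
      ⟨fun w => M (fun k => w (.inl k)) + M' (fun k => w (.inr k)), by fun_prop⟩,
      fun g hg x => ?_, fun X => ?_⟩
    · exact continuous_pi fun k => by cases k <;> simp only [Sum.elim_inl, Sum.elim_inr] <;> fun_prop
    · simp [hψ g hg, hψ' g hg]
    · simp only [ContinuousMap.add_apply, hF, hF', ContinuousMap.coe_mk]
      congr 2 <;> funext k <;> simp
  mul_mem' := by
    rintro F F' ⟨ι, _, ψ, M, hψ, hF⟩ ⟨ι', _, ψ', M', hψ', hF'⟩
    refine ⟨ι ⊕ ι', inferInstance, ⟨fun v => Sum.elim (ψ v) (ψ' v), ?_⟩,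
      ⟨fun w => M (fun k => w (.inl k)) * M' (fun k => w (.inr k)), by fun_prop⟩,
      fun g hg x => ?_, fun X => ?_⟩
    · exact continuous_pi fun k => by cases k <;> simp only [Sum.elim_inl, Sum.elim_inr] <;> fun_prop
    · simp [hψ g hg, hψ' g hg]
    · simp only [ContinuousMap.mul_apply, hF, hF', ContinuousMap.coe_mk]
      congr 2 <;> funext k <;> simp
  algebraMap_mem' r := ⟨Empty, inferInstance, 0, .const _ r, by simp, by simp⟩

lemma rowSum_mem_rowSumAlgebra {ψ : (Fin d → ℝ) → ℝ} (hψ : Continuous ψ)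
    (hinv : ∀ g ∈ H, ∀ v, ψ (permute g v) = ψ v) :
    (⟨fun X => ∑ i, ψ (row X i), continuous_finsetSum _ fun i _ => hψ.comp (continuous_row i)⟩ :
      C(Fin n × Fin d → ℝ, ℝ)) ∈ rowSumAlgebra n H :=
  ⟨Unit, inferInstance, ⟨fun v _ => ψ v, by fun_prop⟩, ⟨fun w => w (), by fun_prop⟩,
    fun g hg x => by simp [hinv g hg], fun X => by simp⟩

/-- A continuous function on a compact set that is invariant under the wreath product is
approximated by functions of sums over rows. -/
lemma exists_mem_rowSumAlgebra_near {K : Set (Fin n × Fin d → ℝ)} (hK : IsCompact K)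
    {f : (Fin n × Fin d → ℝ) → ℝ} (hf : ContinuousOn f K)
    (hinv : ∀ X ∈ K, ∀ Y ∈ K, SameOrbit (wreathGroup n H) X Y → f X = f Y)
    {ε : ℝ} (hε : 0 < ε) : ∃ F ∈ rowSumAlgebra n H, ∀ X ∈ K, |F X - f X| < ε := by
  have : CompactSpace K := isCompact_iff_compactSpace.1 hK
  let s : Setoid K := (orbitSetoid (wreathGroup n H) ℝ).comap Subtype.val
  let mk : C(K, Quotient s) := ⟨Quotient.mk s, continuous_quotient_mk'⟩
  let incl : C(K, Fin n × Fin d → ℝ) := ⟨Subtype.val, continuous_subtype_val⟩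
  -- Functions on the compact orbit space whose pullback to `K` is the restriction of a member of
  -- `rowSumAlgebra`. Stone–Weierstrass applies on this quotient, since on `K` itself invariant
  -- functions need not separate points.
  let A : Subalgebra ℝ C(Quotient s, ℝ) :=
    ((rowSumAlgebra n H).map (ContinuousMap.compRightAlgHom ℝ ℝ incl)).comap
      (ContinuousMap.compRightAlgHom ℝ ℝ mk)
  have hsep : A.SeparatesPoints := by
    intro x y
    refine Quotient.inductionOn₂ x y fun X Y hXY => ?_
    have hne : ¬ SameOrbit (wreathGroup n H) X.1 Y.1 := fun h => hXY (Quotient.sound h)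
    have : ∃ ψ : (Fin d → ℝ) → ℝ, Continuous ψ ∧ (∀ g ∈ H, ∀ v, ψ (permute g v) = ψ v) ∧
        ∑ i, ψ (row X.1 i) ≠ ∑ i, ψ (row Y.1 i) := by
      by_contra! hc
      obtain ⟨q, hq⟩ := exists_perm_sameOrbit hc
      exact hne (sameOrbit_wreathGroup_of_rows q hq)
    obtain ⟨ψ, hψ, hψi, hne⟩ := this
    refine ⟨_, ⟨⟨Quotient.lift (fun X : K => ∑ i, ψ (row X.1 i)) fun X Y h =>
      sum_rows_eq_of_sameOrbit hψi h, ?_⟩, ⟨_, rowSum_mem_rowSumAlgebra hψ hψi, rfl⟩, rfl⟩, hne⟩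
    exact Continuous.quotient_lift (continuous_finsetSum _ fun i _ =>
      hψ.comp ((continuous_row i).comp continuous_subtype_val)) _
  obtain ⟨⟨g, F, hF, hFg⟩, hg⟩ :=
    ContinuousMap.exists_mem_subalgebra_near_continuousMap_of_separatesPoints A hsep
    ⟨Quotient.lift (fun X : K => f X) fun X Y h => hinv X X.2 Y Y.2 h,
      Continuous.quotient_lift hf.domRestrict _⟩ ε hε
  refine ⟨F, hF, fun X hX => ?_⟩
  have h1 := (ContinuousMap.norm_lt_iff _ hε).1 hg (mk ⟨X, hX⟩)
  have h2 : F X = g (mk ⟨X, hX⟩) := congrArg (fun G : C(K, ℝ) => G ⟨X, hX⟩) hFg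
  rw [h2]
  exact h1

/-- The vector-valued version, with one invariant map. -/
lemma exists_rowSum_near {b : ℕ} {K : Set (Fin n × Fin d → ℝ)} (hK : IsCompact K)
    {f : (Fin n × Fin d → ℝ) → (Fin b → ℝ)} (hf : ContinuousOn f K)
    (hinv : ∀ X ∈ K, ∀ Y ∈ K, SameOrbit (wreathGroup n H) X Y → f X = f Y)
    {ε : ℝ} (hε : 0 < ε) :
    ∃ (m : ℕ) (ψ : C(Fin d → ℝ, Fin m → ℝ)) (M : C(Fin m → ℝ, Fin b → ℝ)),
      (∀ g ∈ H, ∀ x, ψ (permute g x) = ψ x) ∧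
      ∀ X ∈ K, dist (M (∑ i, ψ (row X i))) (f X) < ε := by
  choose F hF hFf using fun l => exists_mem_rowSumAlgebra_near (H := H) hK
    (f := fun X => f X l) ((continuous_apply l).comp_continuousOn hf)
    (fun X hX Y hY h => congrFun (hinv X hX Y hY h) l) hε
  choose ι hι ψ M hψ hM using hF
  let e := Fintype.equivFin (Σ l, ι l)
  refine ⟨_, ⟨fun v k => ψ (e.symm k).1 v (e.symm k).2, ?_⟩,
    ⟨fun w l => M l fun k => w (e ⟨l, k⟩), ?_⟩, fun g hg x => ?_, fun X hX => ?_⟩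
  · exact continuous_pi fun k => by fun_prop
  · exact continuous_pi fun l => by fun_prop
  · funext k
    simp [hψ _ g hg]
  · refine (dist_pi_lt_iff hε).2 fun l => ?_
    have := hFf l X hX
    rw [hM] at this
    rw [Real.dist_eq]
    convert this using 3
    refine congrArg (M l) (funext fun k => ?_)
    simp only [Finset.sum_apply]
    exact Finset.sum_congr rfl fun i _ =>
      congrArg (fun q : Σ l, ι l => ψ q.1 (row X i) q.2) (e.symm_apply_apply ⟨l, k⟩)

/-- If `H`-invariant networks are universal, then so are Siamese networks. -/
theorem universalInvariant_siameseNetworks {σ : C(ℝ, ℝ)}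
    (hna : ¬ ∃ α β : ℝ, ∀ t, σ t = α * t + β)
    (hu : UniversalInvariant H (invariantNetworks σ H 1)) :
    UniversalInvariant (wreathGroup n H) (siameseNetworks σ n H) := by
  intro b K hK hKinv f hf hfinv ε hε
  obtain ⟨m, ψ, M, hψ, hM⟩ := exists_rowSum_near (H := H) hK hf
    (by rintro X hX Y - ⟨g, hg, rfl⟩; exact (hfinv g hg X hX).symm)
    (show 0 < ε / 4 by positivity)
  -- The margin 1 leaves room for the error in the inner sums: the perturbed sums stay in a compact
  -- set on which `N` approximates `M` and `M` is uniformly continuous.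
  set C := Metric.cthickening 1 ((fun X : Fin n × Fin d → ℝ => ∑ i, ψ (row X i)) '' K) with hC
  have hcont : Continuous fun X : Fin n × Fin d → ℝ => ∑ i, ψ (row X i) :=
    continuous_finsetSum _ fun i _ => ψ.continuous.comp (continuous_row i)
  have hCc : IsCompact C := (hK.image hcont).cthickening
  obtain ⟨N, hN, hNM⟩ := exists_isMLP_near hna M hCc (show 0 < ε / 4 by positivity)
  obtain ⟨δ, hδ, hMδ⟩ := Metric.uniformContinuousOn_iff.1
    (hCc.uniformContinuousOn_of_continuous M.continuous.continuousOn) (ε / 4) (by positivity)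
  set K' : Set (Fin d → Fin 1 → ℝ) :=
    ⋃ i : Fin n, (fun X : Fin n × Fin d → ℝ => oneChannel (row X i)) '' K with hK'
  -- Dividing by `n + 1` makes the total of `n` errors strictly less than `min δ 1`, even for `n =
  -- 0`.
  have hη : 0 < min δ 1 / (n + 1) := by positivity
  obtain ⟨φ, hφ, hφψ⟩ := hu m K'
    (isCompact_iUnion fun i => hK.image (continuous_oneChannel.comp (continuous_row i)))
    (by
      intro h hh x hx
      obtain ⟨i, X, hX, rfl⟩ := Set.mem_iUnion.1 hx
      -- Applying `h` to every row at once is an element of the wreath group, so the set of rows is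
      -- `H`-invariant.
      exact Set.mem_iUnion.2 ⟨i, _, hKinv _
        (productGroup_le_wreathGroup (prodCongr_mem_productGroup 1 hh)) X hX, rfl⟩)
    (fun x => ψ fun j => x j 0) (by fun_prop)
    (fun h hh x _ => hψ h hh fun j => x j 0) _ hη
  refine ⟨_, ⟨m, φ, N, hφ, hN, fun X => rfl⟩, fun X hX => ?_⟩
  set w := ∑ i, φ (oneChannel (row X i)) with hw
  set w' := ∑ i, ψ (row X i) with hw'
  have hww' : dist w w' < min δ 1 := by
    calc dist w w' ≤ ∑ i : Fin n, dist (φ (oneChannel (row X i))) (ψ (row X i)) :=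
          dist_sum_sum_le _ _ _
      _ ≤ ∑ _i : Fin n, min δ 1 / (n + 1) := Finset.sum_le_sum fun i _ =>
          (hφψ _ (Set.mem_iUnion.2 ⟨i, X, hX, rfl⟩)).le
      _ = n * (min δ 1 / (n + 1)) := by simp
      _ < min δ 1 := by
        have : 0 < min δ 1 := by positivity
        rw [mul_div_assoc', div_lt_iff₀ (by positivity)]
        nlinarith
  have hw'C : w' ∈ C := Metric.self_subset_cthickening _ ⟨X, hX, rfl⟩
  have hwC : w ∈ C := Metric.mem_cthickening_of_dist_le w w' 1 _ ⟨X, hX, rfl⟩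
    (hww'.le.trans (min_le_right _ _))
  have h1 := hNM w hwC
  have h2 := hMδ w hwC w' hw'C (hww'.trans_le (min_le_left _ _))
  have h3 := hM X hX
  calc dist (N w) (f X) ≤ dist (N w) (M w) + dist (M w) (M w') + dist (M w') (f X) :=
        dist_triangle4 _ _ _ _
    _ < ε := by linarith

end Siamese

/-! ### DSS networks simulate Siamese networks -/

section Simulation

variable {σ : ℝ → ℝ}

/-- An affine map applied at each coordinate. -/
def pointwiseAffine (ι : Type*) {a b : ℕ} (A : (Fin a → ℝ) →ᵃ[ℝ] (Fin b → ℝ)) :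
    (ι → Fin a → ℝ) →ᵃ[ℝ] (ι → Fin b → ℝ) :=
  AffineMap.pi fun i => A.comp (LinearMap.proj i).toAffineMap

section

variable {ι : Type*} {G : Subgroup (Perm ι)}

lemma isEquivariantLayer_pointwiseAffine {a b : ℕ} (A : (Fin a → ℝ) →ᵃ[ℝ] (Fin b → ℝ)) :
    IsEquivariantLayer G (pointwiseAffine ι A) := fun _ _ _ => rfl

lemma IsEquivariantNetwork.mlp_comp {a b c : ℕ} {f : (ι → Fin a → ℝ) → (ι → Fin b → ℝ)}
    (hf : IsEquivariantNetwork σ G f) {m : (Fin b → ℝ) → (Fin c → ℝ)} (hm : IsMLP σ m) :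
    IsEquivariantNetwork σ G fun x i => m fun k => σ (f x i k) := by
  induction hm with
  | single A => exact .cons f hf _ (isEquivariantLayer_pointwiseAffine A)
  | cons M _ A ih => exact .cons _ ih _ (isEquivariantLayer_pointwiseAffine A)

lemma IsEquivariantNetwork.comp_layer {a b c : ℕ} {f : (ι → Fin b → ℝ) → (ι → Fin c → ℝ)}
    (hf : IsEquivariantNetwork σ G f) {L : (ι → Fin a → ℝ) →ᵃ[ℝ] (ι → Fin b → ℝ)}
    (hL : IsEquivariantLayer G L) : IsEquivariantNetwork σ G fun x => f (L x) := by
  induction hf with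
  | single L' hL' =>
    exact .single (L'.comp L) fun g hg x => by
      rw [AffineMap.comp_apply, hL g hg, hL' g hg, AffineMap.comp_apply]
  | cons f _ L' hL' ih => exact .cons _ ih L' hL'

lemma comp_layer_mem_invariantNetworks {a b c : ℕ} {N : (ι → Fin b → ℝ) → (Fin c → ℝ)}
    (hN : N ∈ invariantNetworks σ G b c) {L : (ι → Fin a → ℝ) →ᵃ[ℝ] (ι → Fin b → ℝ)}
    (hL : IsEquivariantLayer G L) : (fun x => N (L x)) ∈ invariantNetworks σ G a c := by
  obtain ⟨p, q, f, h, m, hf, hh, hm, hN⟩ := hN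
  exact ⟨p, q, _, h, m, hf.comp_layer hL, hh, hm, fun x => hN (L x)⟩

/-- An invariant network can be computed at each coordinate by an equivariant network. -/
lemma exists_equivariant_of_mem_invariantNetworks {c a : ℕ}
    {φ : (ι → Fin c → ℝ) → (Fin a → ℝ)} (hφ : φ ∈ invariantNetworks σ G c a) :
    ∃ (r : ℕ) (g : (ι → Fin c → ℝ) → (ι → Fin r → ℝ)) (A : (Fin r → ℝ) →ᵃ[ℝ] (Fin a → ℝ)),
      IsEquivariantNetwork σ G g ∧ ∀ x i, φ x = A fun k => σ (g x i k) := by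
  obtain ⟨p, q, f, h, m, hf, hh, hm, hN⟩ := hφ
  -- Copying an invariant value to every coordinate turns an invariant layer into an equivariant
  -- one, so the perceptron can run at each coordinate.
  have hg : IsEquivariantNetwork σ G fun x (_ : ι) => h fun i k => σ (f x i k) :=
    .cons f hf (AffineMap.pi fun _ => h) fun g hg x => funext fun _ => hh g hg x
  cases hm with
  | single A => exact ⟨q, _, A, hg, fun x _ => hN x⟩
  | cons M hM A => exact ⟨_, _, A, hg.mlp_comp hM, fun x _ => hN x⟩

end

variable {n d : ℕ} {H : Subgroup (Perm (Fin d))}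

/-- An affine map applied to each row. -/
def rowwiseAffine (n : ℕ) {a b : ℕ} (L : (Fin d → Fin a → ℝ) →ᵃ[ℝ] (Fin d → Fin b → ℝ)) :
    (Fin n × Fin d → Fin a → ℝ) →ᵃ[ℝ] (Fin n × Fin d → Fin b → ℝ) :=
  AffineMap.pi fun p => (LinearMap.proj p.2).toAffineMap.comp
    (L.comp (LinearMap.funLeft ℝ (Fin a → ℝ) fun j => (p.1, j)).toAffineMap)

lemma row_permute_of_product {V : Type*} {g : Perm (Fin n × Fin d)} {q : Perm (Fin n)}
    {h : Perm (Fin d)} (hg : ∀ i j, g (i, j) = (q i, h j)) (X : Fin n × Fin d → V) (i : Fin n) :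
    (fun j => permute g X (q i, j)) = permute h fun j => X (i, j) := by
  funext j
  have : g⁻¹ (q i, j) = (i, h⁻¹ j) := by
    rw [Perm.inv_eq_iff_eq, hg]
    simp
  simp [this]

lemma isEquivariantLayer_rowwiseAffine {a b : ℕ}
    {L : (Fin d → Fin a → ℝ) →ᵃ[ℝ] (Fin d → Fin b → ℝ)} (hL : IsEquivariantLayer H L) :
    IsEquivariantLayer (productGroup n H) (rowwiseAffine n L) := by
  rintro g ⟨q, h, hh, hg⟩ X
  refine (permute_eq_iff.2 ?_).symm
  rintro ⟨i, j⟩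
  rw [hg]
  change L (fun j => X (i, j)) j = L (fun j => permute g X (q i, j)) (h j)
  rw [row_permute_of_product hg, hL h hh]
  simp

lemma IsEquivariantNetwork.rowwise {a b : ℕ} {f : (Fin d → Fin a → ℝ) → (Fin d → Fin b → ℝ)}
    (hf : IsEquivariantNetwork σ H f) :
    IsEquivariantNetwork σ (productGroup n H) fun X p => f (fun j => X (p.1, j)) p.2 := by
  induction hf with
  | single L hL => exact .single _ (isEquivariantLayer_rowwiseAffine hL)
  | cons f _ L hL ih => exact .cons _ ih _ (isEquivariantLayer_rowwiseAffine hL)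

/-- The sum over all coordinates, as an invariant linear layer. -/
def coordinateSum (ι : Type*) [Fintype ι] (a : ℕ) : (ι → Fin a → ℝ) →ₗ[ℝ] (Fin a → ℝ) :=
  ∑ i, LinearMap.proj i

lemma coordinateSum_apply {ι : Type*} [Fintype ι] {a : ℕ} (x : ι → Fin a → ℝ) :
    coordinateSum ι a x = ∑ i, x i := by
  simp [coordinateSum]

lemma coordinateSum_permute {ι : Type*} [Fintype ι] {a : ℕ} (g : Perm ι) (x : ι → Fin a → ℝ) :
    coordinateSum ι a (permute g x) = coordinateSum ι a x := by
  rw [coordinateSum_apply, coordinateSum_apply]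
  exact Equiv.sum_comp g⁻¹ x

/-- Summing an invariant network over rows, and applying a multilayer perceptron with a hidden
layer, gives a network that is invariant under the product group. -/
lemma sum_rows_mem_invariantNetworks {a c e b : ℕ} {φ : (Fin d → Fin c → ℝ) → (Fin a → ℝ)}
    (hφ : φ ∈ invariantNetworks σ H c a) (A : (Fin a → ℝ) →ᵃ[ℝ] (Fin e → ℝ))
    {M : (Fin e → ℝ) → (Fin b → ℝ)} (hM : IsMLP σ M) :
    (fun X : Fin n × Fin d → Fin c → ℝ =>
      M fun k => σ (A (∑ i, φ fun j => X (i, j)) k)) ∈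
      invariantNetworks σ (productGroup n H) c b := by
  obtain ⟨r, g, B, hg, hgB⟩ := exists_equivariant_of_mem_invariantNetworks hφ
  suffices h : ∃ h₀ : (Fin n × Fin d → Fin r → ℝ) →ᵃ[ℝ] (Fin a → ℝ),
      IsInvariantLayer (productGroup n H) h₀ ∧ ∀ X : Fin n × Fin d → Fin c → ℝ,
        h₀ (fun p k => σ (g (fun j => X (p.1, j)) p.2 k)) = ∑ i, φ fun j => X (i, j) by
    obtain ⟨h₀, hinv, hh₀⟩ := h
    exact ⟨r, e, _, A.comp h₀, M, hg.rowwise, fun g hg x => congrArg A (hinv g hg x), hM,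
      fun X => by simp only [AffineMap.comp_apply, hh₀]⟩
  -- For `d = 0` there is no coordinate to carry a copy of `φ`. Its value is then constant and goes
  -- into the bias.
  obtain rfl | hd := Nat.eq_zero_or_pos d
  · refine ⟨AffineMap.const ℝ _ (∑ _i : Fin n, φ fun j => j.elim0), fun _ _ _ => rfl, fun X => ?_⟩
    simp only [AffineMap.const_apply]
    exact Finset.sum_congr rfl fun i _ => congrArg φ (Subsingleton.elim _ _)
  -- Each row holds its value `d` times, once per column, hence the factor `d⁻¹`.
  · refine ⟨(d : ℝ)⁻¹ • ((coordinateSum (Fin n × Fin d) a).toAffineMap.comp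
      (pointwiseAffine _ B)), fun g hg x => ?_, fun X => ?_⟩
    · simp only [AffineMap.coe_smul, Pi.smul_apply, AffineMap.comp_apply,
        LinearMap.coe_toAffineMap, isEquivariantLayer_pointwiseAffine B g hg,
        coordinateSum_permute]
    · simp only [AffineMap.coe_smul, Pi.smul_apply, AffineMap.comp_apply,
        LinearMap.coe_toAffineMap, coordinateSum_apply, Fintype.sum_prod_type]
      have : ∀ i : Fin n, ∑ j : Fin d, pointwiseAffine (Fin n × Fin d) B
          (fun p k => σ (g (fun j => X (p.1, j)) p.2 k)) (i, j) = (d : ℝ) • φ fun j => X (i, j) := by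
        intro i
        refine (Finset.sum_congr rfl fun j _ => (hgB (fun j => X (i, j)) j).symm).trans ?_
        simp [← Nat.cast_smul_eq_nsmul ℝ]
      rw [Finset.sum_congr rfl fun i _ => this i, ← Finset.smul_sum, smul_smul,
        inv_mul_cancel₀ (by positivity), one_smul]

/-- A Siamese network whose final multilayer perceptron has a hidden layer is a DSS network. -/
lemma siamese_mem_dssNetworks {a e b : ℕ} {φ : (Fin d → Fin 1 → ℝ) → (Fin a → ℝ)}
    (hφ : φ ∈ invariantNetworks σ H 1 a) (A : (Fin a → ℝ) →ᵃ[ℝ] (Fin e → ℝ))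
    {M : (Fin e → ℝ) → (Fin b → ℝ)} (hM : IsMLP σ M) :
    (fun X => M fun k => σ (A (∑ i, φ (oneChannel (row X i))) k)) ∈ dssNetworks σ n H b :=
  ⟨_, sum_rows_mem_invariantNetworks hφ A hM, fun _ => rfl⟩

/-- Limits of Siamese networks are limits of DSS networks. -/
lemma approximable_siameseNetworks_subset {σ : C(ℝ, ℝ)}
    (hna : ¬ ∃ α β : ℝ, ∀ t, σ t = α * t + β) (b : ℕ) :
    approximable (siameseNetworks σ n H b) ⊆ approximable (dssNetworks σ n H b) := by
  intro f hf K hK ε hε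
  obtain ⟨F, ⟨a, φ, M, hφ, hM, hF⟩, hFf⟩ := hf K hK (ε / 2) (by positivity)
  let M' : C(Fin a → ℝ, Fin b → ℝ) := ⟨M, hM.continuous σ.continuous⟩
  -- `M` may have no hidden layer, so an approximate identity with one hidden layer is inserted
  -- between the sum and `M`.
  have hcl : M' ∈ closure ((fun I => M'.comp I) '' oneHiddenSet σ a a) :=
    map_mem_closure (f := fun I => M'.comp I) (ContinuousMap.continuous_postcomp M')
      (id_mem_closure_oneHiddenSet hna) fun I hI => ⟨I, hI, rfl⟩
  have hcont : Continuous fun X : Fin n × Fin d → ℝ => ∑ i, φ (oneChannel (row X i)) :=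
    continuous_finsetSum _ fun i _ => (continuous_of_mem_invariantNetworks σ.continuous hφ).comp
      (continuous_oneChannel.comp (continuous_row i))
  obtain ⟨_, ⟨I, ⟨r, B, A, hI⟩, rfl⟩, hIM⟩ := mem_closure_iff_forall_isCompact.1 hcl _
    (hK.image hcont) (ε / 2) (by positivity)
  refine ⟨_, siamese_mem_dssNetworks hφ B (hM.comp (.single A)), fun X hX => ?_⟩
  have h1 := hIM _ ⟨X, hX, rfl⟩
  have h2 := hFf X hX
  rw [hF] at h2
  rw [ContinuousMap.comp_apply, hI] at h1
  calc _ ≤ _ := dist_triangle _ (M (∑ i, φ (oneChannel (row X i)))) _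
    _ < ε / 2 + ε / 2 := add_lt_add h1 h2
    _ = ε := add_halves ε

/-! ### Separation by DSS networks -/

lemma exists_ne_of_not_affine (hna : ¬ ∃ α β : ℝ, ∀ t, σ t = α * t + β) :
    ∃ s t, σ s ≠ σ t := by
  by_contra! hc
  exact hna ⟨0, σ 0, fun t => by simpa using hc t 0⟩

/-- If an affine function of the data can be separated, so can the activation of one. -/
lemma exists_affine_activation_ne (hna : ¬ ∃ α β : ℝ, ∀ t, σ t = α * t + β) {a : ℕ}
    {x y : Fin a → ℝ} (hxy : x ≠ y) (b : ℕ) :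
    ∃ A : (Fin a → ℝ) →ᵃ[ℝ] (Fin b → ℝ), ∀ k, σ (A x k) ≠ σ (A y k) := by
  obtain ⟨s, t, hst⟩ := exists_ne_of_not_affine hna
  obtain ⟨i, hi⟩ := Function.ne_iff.1 hxy
  have hi' : x i - y i ≠ 0 := sub_ne_zero.2 hi
  let B : (Fin a → ℝ) →ᵃ[ℝ] ℝ := ((s - t) / (x i - y i)) • (LinearMap.proj i).toAffineMap +
    AffineMap.const ℝ _ (s - (s - t) / (x i - y i) * x i)
  refine ⟨AffineMap.pi fun _ => B, fun _ => ?_⟩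
  have hx : B x = s := by simp [B]
  have hy : B y = t := by
    simp [B]
    field_simp
    ring
  rw [AffineMap.pi_apply, AffineMap.pi_apply, hx, hy]
  exact hst

/-- The layer that appends the sum of all rows to each row, in a second channel. -/
def appendRowSum (n d : ℕ) : (Fin n × Fin d → Fin 1 → ℝ) →ₗ[ℝ] (Fin n × Fin d → Fin 2 → ℝ) :=
  LinearMap.pi fun p => LinearMap.pi
    ![LinearMap.proj 0 ∘ₗ LinearMap.proj p, ∑ i, LinearMap.proj 0 ∘ₗ LinearMap.proj (i, p.2)]

lemma appendRowSum_apply (X : Fin n × Fin d → Fin 1 → ℝ) (p : Fin n × Fin d) :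
    appendRowSum n d X p = ![X p 0, ∑ i, X (i, p.2) 0] := by
  funext k
  fin_cases k <;> simp [appendRowSum]

lemma isEquivariantLayer_appendRowSum :
    IsEquivariantLayer (productGroup n H) (appendRowSum n d).toAffineMap := by
  rintro g ⟨q, h, hh, hg⟩ X
  refine (permute_eq_iff.2 ?_).symm
  rintro ⟨i, j⟩
  simp only [LinearMap.coe_toAffineMap, appendRowSum_apply, hg]
  have hX : ∀ i, permute g X (q i, h j) = X (i, j) := fun i => by
    rw [← hg]
    simp
  rw [hX, ← Equiv.sum_comp q fun i => permute g X (i, h j) 0]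
  simp only [hX]

/-- DSS networks separate orbits outside the exceptional set, if `H`-invariant networks with two
channels are universal. -/
lemma exists_dssNetwork_ne (hna : ¬ ∃ α β : ℝ, ∀ t, σ t = α * t + β)
    (hu : UniversalInvariant H (invariantNetworks σ H 2)) {X Y : Fin n × Fin d → ℝ}
    (hX : X ∉ exceptionalSet n d) (hXY : ¬ SameOrbit (productGroup n H) X Y) :
    ∃ F ∈ dssNetworks σ n H 1, F X ≠ F Y := by
  let x : (Fin n × Fin d → ℝ) → Fin n → Fin d → Fin 2 → ℝ := fun X i j =>
    appendRowSum n d (oneChannel X) (i, j)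
  have hx0 : ∀ X i j, x X i j 0 = X (i, j) := fun X i j => by simp [x, appendRowSum_apply, oneChannel]
  have hx1 : ∀ X i j, x X i j 1 = ∑ i, X (i, j) := fun X i j => by
    simp [x, appendRowSum_apply, oneChannel]
  have : ∃ ψ : (Fin d → Fin 2 → ℝ) → ℝ, Continuous ψ ∧
      (∀ g ∈ H, ∀ v, ψ (permute g v) = ψ v) ∧ ∑ i, ψ (x X i) ≠ ∑ i, ψ (x Y i) := by
    by_contra! hc
    obtain ⟨q, hq⟩ := exists_perm_sameOrbit hc
    choose h hh hq using hq
    have hq' := fun i => permute_eq_iff.1 (hq i)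
    obtain hn | ⟨⟨i₀⟩⟩ := isEmpty_or_nonempty (Fin n)
    · exact hXY (Subsingleton.elim X Y ▸ SameOrbit.refl _ X)
    -- The second channel is the same in all rows: each `h i` carries the column sums of `X` to
    -- those of `Y`. As the former are pairwise distinct, this determines `h i`.
    have heq : ∀ i, h i = h i₀ := by
      intro i
      refine Equiv.ext fun j => ?_
      obtain ⟨k, hk⟩ := (h i₀).surjective (h i j)
      have e1 := congrFun (hq' i j) 1
      have e2 := congrFun (hq' i₀ k) 1
      rw [hx1, hx1] at e1 e2
      rw [hk] at e2
      by_contra hne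
      exact hX ⟨j, k, fun hjk => hne (hjk ▸ hk.symm), e1.trans e2.symm⟩
    refine hXY (sameOrbit_productGroup_of_rows q (hh i₀) fun i j => ?_)
    have e := congrFun (hq' i j) 0
    rwa [hx0, hx0, heq] at e
  obtain ⟨ψ, hψ, hinv, hne⟩ := this
  set δ := |∑ i, ψ (x X i) - ∑ i, ψ (x Y i)| with hδ
  have hδ0 : 0 < δ := abs_pos.2 (sub_ne_zero.2 hne)
  have hη : 0 < δ / (2 * (n + 1)) := by positivity
  have := Fintype.ofFinite H
  -- The orbits of the augmented rows of `X` and `Y` form a finite set, so approximating `ψ` there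
  -- is enough.
  let K : Set (Fin d → Fin 2 → ℝ) := {v | ∃ i, SameOrbit H (x X i) v ∨ SameOrbit H (x Y i) v}
  have hK : K.Finite := by
    have : K ⊆ Set.range (fun p : Fin n × H => permute p.2.1 (x X p.1)) ∪
        Set.range (fun p : Fin n × H => permute p.2.1 (x Y p.1)) := by
      rintro v ⟨i, ⟨h, hh, rfl⟩ | ⟨h, hh, rfl⟩⟩
      exacts [.inl ⟨(i, ⟨h, hh⟩), rfl⟩, .inr ⟨(i, ⟨h, hh⟩), rfl⟩]
    exact ((Set.finite_range _).union (Set.finite_range _)).subset this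
  obtain ⟨φ, hφ, hφψ⟩ := hu 1 K hK.isCompact
    (fun h hh v ⟨i, hi⟩ => ⟨i, hi.imp (fun hi => hi.trans ⟨h, hh, rfl⟩)
      (fun hi => hi.trans ⟨h, hh, rfl⟩)⟩)
    (fun v _ => ψ v) (by fun_prop) (fun h hh v _ => funext fun _ => hinv h hh v) _ hη
  have happrox : ∀ Z, (∀ i, x Z i ∈ K) → |(∑ i, φ (x Z i)) 0 - ∑ i, ψ (x Z i)| < δ / 2 := by
    intro Z hZ
    rw [Finset.sum_apply, ← Real.dist_eq]
    calc _ ≤ ∑ i, dist (φ (x Z i) 0) (ψ (x Z i)) := dist_sum_sum_le _ _ _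
      _ ≤ ∑ _i : Fin n, δ / (2 * (n + 1)) := Finset.sum_le_sum fun i _ =>
        ((dist_le_pi_dist (φ (x Z i)) (fun _ => ψ (x Z i)) 0).trans (hφψ _ (hZ i)).le)
      _ = n * (δ / (2 * (n + 1))) := by simp
      _ < δ / 2 := by
        rw [mul_div_assoc', div_lt_iff₀ (by positivity)]
        nlinarith
  have hne' : ∑ i, φ (x X i) ≠ ∑ i, φ (x Y i) := by
    intro heq
    have h1 := happrox X fun i => ⟨i, .inl (.refl H _)⟩
    have h2 := happrox Y fun i => ⟨i, .inr (.refl H _)⟩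
    rw [heq, abs_sub_comm] at h1
    have := abs_add_le (∑ i, ψ (x X i) - (∑ i, φ (x Y i)) 0)
      ((∑ i, φ (x Y i)) 0 - ∑ i, ψ (x Y i))
    rw [sub_add_sub_cancel, ← hδ] at this
    linarith
  obtain ⟨A, hA⟩ := exists_affine_activation_ne hna hne' 1
  refine ⟨_, ⟨_, comp_layer_mem_invariantNetworks
    (sum_rows_mem_invariantNetworks hφ A (.single (AffineMap.id ℝ (Fin 1 → ℝ))))
    isEquivariantLayer_appendRowSum, fun X => rfl⟩, fun heq => hA 0 (congrFun heq 0)⟩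

end Simulation

/-! ### Orbits that Siamese networks do not separate -/

section Strictness

variable {n d : ℕ} {H : Subgroup (Perm (Fin d))}

/-- DSS networks separate inputs whose column sums have different Euclidean norms. -/
lemma exists_dssNetwork_ne_of_columnSums {σ : C(ℝ, ℝ)}
    (hna : ¬ ∃ α β : ℝ, ∀ t, σ t = α * t + β) (hn : 0 < n) {X Y : Fin n × Fin d → ℝ}
    (hXY : ∑ j, (∑ i, X (i, j)) ^ 2 ≠ ∑ j, (∑ i, Y (i, j)) ^ 2) (b : ℕ) :
    ∃ F ∈ dssNetworks σ n H b, ∀ k, F X k ≠ F Y k := by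
  have : ∃ α β : ℝ, ∑ j, σ (α * ∑ i, X (i, j) + β) ≠ ∑ j, σ (α * ∑ i, Y (i, j) + β) := by
    by_contra! hc
    -- If no `σ (α t + β)` distinguished the column sums, this continuous functional would vanish on
    -- the closed span of these functions, hence on `t ^ 2`, against `hXY`.
    let T : C(ℝ, ℝ) →ₗ[ℝ] ℝ :=
      { toFun := fun g => ∑ j, g (∑ i, X (i, j)) - ∑ j, g (∑ i, Y (i, j))
        map_add' := fun g g' => by simp [Finset.sum_add_distrib]; ring
        map_smul' := fun r g => by simp [← Finset.mul_sum, mul_sub] }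
    have hT : Continuous T :=
      (continuous_finsetSum _ fun j _ => continuous_eval_const _).sub
        (continuous_finsetSum _ fun j _ => continuous_eval_const _)
    have h := topologicalClosure_span_le_comap T hT (P := ⊥) (by simp)
      (s := Set.range fun p : ℝ × ℝ => σ.comp (affineReal p.1 p.2)) (by
        rintro _ ⟨p, rfl⟩
        exact sub_eq_zero.2 (hc p.1 p.2)) (sqMap_mem_ridgeSpan hna)
    exact hXY (sub_eq_zero.1 h)
  obtain ⟨α, β, hne⟩ := this
  let C : (Fin 2 → ℝ) →ᵃ[ℝ] (Fin 1 → ℝ) := AffineMap.pi fun _ =>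
    α • (LinearMap.proj 1).toAffineMap + AffineMap.const ℝ _ β
  have hf : IsEquivariantNetwork σ (productGroup n H) _ :=
    (IsEquivariantNetwork.single (pointwiseAffine (Fin n × Fin d) C)
      (isEquivariantLayer_pointwiseAffine C)).comp_layer isEquivariantLayer_appendRowSum
  have hsum : ∀ Z : Fin n × Fin d → ℝ, coordinateSum (Fin n × Fin d) 1 (fun p k =>
      σ (pointwiseAffine (Fin n × Fin d) C
        ((appendRowSum n d).toAffineMap (oneChannel Z)) p k)) 0 =
      n * ∑ j, σ (α * ∑ i, Z (i, j) + β) := by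
    intro Z
    have : ∀ p k, pointwiseAffine (Fin n × Fin d) C
        ((appendRowSum n d).toAffineMap (oneChannel Z)) p k = α * ∑ i, Z (i, p.2) + β := by
      intro p k
      change α * (appendRowSum n d (oneChannel Z) p) 1 + β = _
      rw [appendRowSum_apply]
      rfl
    simp only [this, coordinateSum_apply, Finset.sum_apply, Fintype.sum_prod_type,
      Finset.sum_const, Finset.card_univ, Fintype.card_fin, nsmul_eq_mul]
  obtain ⟨A, hA⟩ := exists_affine_activation_ne hna
    (x := coordinateSum (Fin n × Fin d) 1 (fun p k => σ (pointwiseAffine (Fin n × Fin d) C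
      ((appendRowSum n d).toAffineMap (oneChannel X)) p k)))
    (y := coordinateSum (Fin n × Fin d) 1 (fun p k => σ (pointwiseAffine (Fin n × Fin d) C
      ((appendRowSum n d).toAffineMap (oneChannel Y)) p k))) (fun heq => by
      have := congrFun heq 0
      rw [hsum, hsum] at this
      exact hne (mul_left_cancel₀ (by positivity) this)) b
  exact ⟨_, ⟨_, ⟨1, b, _, A.comp (coordinateSum (Fin n × Fin d) 1).toAffineMap, _, hf,
    fun g _ x => congrArg A (coordinateSum_permute g x), .single (AffineMap.id ℝ _),
    fun _ => rfl⟩, fun _ => rfl⟩, hA⟩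

/-- For nontrivial `H` there are two inputs outside the exceptional set in one orbit of the wreath
product whose column sums have different Euclidean norms. -/
lemma exists_sameOrbit_columnSums_ne (hn : 2 ≤ n) (hH : H ≠ ⊥) :
    ∃ X Y : Fin n × Fin d → ℝ, X ∉ exceptionalSet n d ∧ Y ∉ exceptionalSet n d ∧
      SameOrbit (wreathGroup n H) X Y ∧
      ∑ j, (∑ i, X (i, j)) ^ 2 ≠ ∑ j, (∑ i, Y (i, j)) ^ 2 := by
  obtain ⟨h, hh, h1⟩ := exists_mem_ne_one_of_ne_bot hH
  obtain ⟨n, rfl⟩ : ∃ m, n = m + 2 := ⟨n - 2, by omega⟩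
  -- Row 0 is `(0, …, d - 1)` permuted by `g`, row 1 is `d` times the unpermuted vector, the rest is
  -- zero. The column sums are two-digit numbers in base `d` with leading digits `j`, hence distinct
  -- for every `g`. Only row 0 depends on `g`, so a wreath element relates `Z 1` and `Z h`.
  let Z : Perm (Fin d) → Fin (n + 2) × Fin d → ℝ := fun g p =>
    (Fin.cons ((g⁻¹ p.2 : Fin d) : ℝ) (Fin.cons (d * (p.2 : ℝ)) fun _ => 0) : Fin (n + 2) → ℝ) p.1
  have hsum : ∀ g j, ∑ i, Z g (i, j) = ((g⁻¹ j : Fin d) : ℝ) + d * (j : ℝ) := fun g j => by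
    simp [Z, Fin.sum_univ_succ]
  have hex : ∀ g, Z g ∉ exceptionalSet (n + 2) d := by
    rintro g ⟨j, k, hjk, heq⟩
    rw [hsum, hsum] at heq
    have heq' : ((g⁻¹ j : Fin d) : ℕ) + d * j = (g⁻¹ k : Fin d) + d * k := by exact_mod_cast heq
    have hd : 0 < d := j.pos
    have := congrArg (· / d) heq'
    simp only [Nat.add_mul_div_left _ _ hd, Nat.div_eq_of_lt (Fin.is_lt _), zero_add] at this
    exact hjk (Fin.ext this)
  refine ⟨Z 1, Z h, hex 1, hex h, sameOrbit_wreathGroup_of_rows 1 fun i => ?_, ?_⟩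
  · refine Fin.cases ⟨h, hh, ?_⟩ (fun i => ⟨1, H.one_mem, ?_⟩) i
    · rfl
    · funext j
      simp [row, Z]
  · simp only [hsum]
    have hsq : ∑ j : Fin d, (((h⁻¹ j : Fin d) : ℝ)) ^ 2 = ∑ j : Fin d, (j : ℝ) ^ 2 :=
      Equiv.sum_comp h⁻¹ fun j : Fin d => (j : ℝ) ^ 2
    -- The rearrangement inequality in explicit form: permuting one row changes only the cross
    -- terms, and the loss is `d` times the squared distance between `j` and `h⁻¹ j`.
    have hdiff : ∑ j : Fin d, ((((1 : Perm (Fin d))⁻¹ j : Fin d) : ℝ) + d * (j : ℝ)) ^ 2 -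
        ∑ j : Fin d, (((h⁻¹ j : Fin d) : ℝ) + d * (j : ℝ)) ^ 2 =
        d * ∑ j : Fin d, ((j : ℝ) - (h⁻¹ j : Fin d)) ^ 2 +
        (1 + d) * (∑ j : Fin d, (j : ℝ) ^ 2 - ∑ j : Fin d, (((h⁻¹ j : Fin d) : ℝ)) ^ 2) := by
      simp only [← Finset.sum_sub_distrib, Finset.mul_sum, ← Finset.sum_add_distrib]
      refine Finset.sum_congr rfl fun j _ => ?_
      simp
      ring
    rw [hsq, sub_self, mul_zero, add_zero] at hdiff
    obtain ⟨j, hj⟩ : ∃ j, h⁻¹ j ≠ j := by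
      by_contra! hc
      exact h1 (inv_eq_one.1 (Equiv.ext hc))
    have hd : 0 < d := j.pos
    have hpos : 0 < ∑ j : Fin d, ((j : ℝ) - (h⁻¹ j : Fin d)) ^ 2 := by
      refine Finset.sum_pos' (fun _ _ => sq_nonneg _) ⟨j, Finset.mem_univ j, ?_⟩
      have : (j : ℝ) - (h⁻¹ j : Fin d) ≠ 0 := sub_ne_zero.2 fun heq =>
        hj (Fin.ext (by exact_mod_cast heq.symm))
      positivity
    have : 0 < (d : ℝ) * ∑ j : Fin d, ((j : ℝ) - (h⁻¹ j : Fin d)) ^ 2 := by positivity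
    rw [← hdiff] at this
    exact (sub_pos.1 this).ne'

lemma mem_approximable_of_mem {E : Type*} [TopologicalSpace E] {b : ℕ}
    {𝒩 : Set (E → (Fin b → ℝ))} {F : E → (Fin b → ℝ)} (hF : F ∈ 𝒩) : F ∈ approximable 𝒩 :=
  fun _ _ ε hε => ⟨F, hF, fun x _ => by simpa using hε⟩

/-- Limits of Siamese networks are invariant under the wreath product. -/
lemma eq_of_sameOrbit_of_mem_approximable {σ : ℝ → ℝ} {b : ℕ}
    {F : (Fin n × Fin d → ℝ) → (Fin b → ℝ)} (hF : F ∈ approximable (siameseNetworks σ n H b))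
    {X Y : Fin n × Fin d → ℝ} (hXY : SameOrbit (wreathGroup n H) X Y) : F X = F Y := by
  refine eq_of_forall_dist_le fun ε hε => ?_
  -- The two-point set is compact, and `N` takes equal values on it.
  obtain ⟨N, hN, hNF⟩ := hF {X, Y} (Set.toFinite _).isCompact (ε / 2) (by positivity)
  have hX := hNF X (by simp)
  have hY := hNF Y (by simp)
  rw [eq_of_sameOrbit_of_mem_siameseNetworks hN hXY, dist_comm] at hX
  linarith [dist_triangle (F X) (N Y) (F Y)]

end Strictness

end SymmetricSets

theorem mainTheorem4 (σ : ℝ → ℝ) (hσ : Continuous σ)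
    (hna : ¬ ∃ α β : ℝ, ∀ t, σ t = α * t + β)
    (n d : ℕ) (H : Subgroup (Equiv.Perm (Fin d))) :
    -- the wreath-product group contains `S_n × H`, strictly if `H` is nontrivial
    (productGroup n H ≤ wreathGroup n H ∧
      (2 ≤ n → H ≠ ⊥ → productGroup n H < wreathGroup n H)) ∧
    -- DSS networks are invariant under `S_n × H`, Siamese networks under the wreath product
    (∀ b : ℕ, ∀ F ∈ dssNetworks σ n H b, ∀ X Y,
      SameOrbit (productGroup n H) X Y → F X = F Y) ∧
    (∀ b : ℕ, ∀ F ∈ siameseNetworks σ n H b, ∀ X Y,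
      SameOrbit (wreathGroup n H) X Y → F X = F Y) ∧
    -- if `H`-invariant networks are universal, then Siamese networks are universal for the
    -- wreath-product symmetries, and DSS networks separate any two `S_n × H`-orbits outside the
    -- exceptional set
    ((∀ c : ℕ, UniversalInvariant H (invariantNetworks σ H c)) →
      UniversalInvariant (wreathGroup n H) (siameseNetworks σ n H) ∧
      ∀ X Y, X ∉ exceptionalSet n d → Y ∉ exceptionalSet n d →
        ¬ SameOrbit (productGroup n H) X Y → ∃ F ∈ dssNetworks σ n H 1, F X ≠ F Y) ∧
    -- DSS networks simulate Siamese networks: exactly, if the final multilayer perceptron has a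
    -- hidden layer, and up to arbitrarily small errors on compact sets in general
    (∀ (a e b : ℕ) (φ : (Fin d → Fin 1 → ℝ) → (Fin a → ℝ))
      (A : (Fin a → ℝ) →ᵃ[ℝ] (Fin e → ℝ)) (M : (Fin e → ℝ) → (Fin b → ℝ)),
      φ ∈ invariantNetworks σ H 1 a → IsMLP σ M →
      (fun X => M (fun k => σ (A (∑ i, φ (oneChannel (row X i))) k))) ∈ dssNetworks σ n H b) ∧
    (∀ b : ℕ, approximable (siameseNetworks σ n H b) ⊆ approximable (dssNetworks σ n H b)) ∧
    -- for nontrivial `H`, some `S_n × H`-orbits are separated by a DSS network, but by no Siamese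
    -- network, and DSS networks are strictly more expressive than Siamese networks
    (2 ≤ n → H ≠ ⊥ →
      (∃ X Y, X ∉ exceptionalSet n d ∧ Y ∉ exceptionalSet n d ∧
        SameOrbit (wreathGroup n H) X Y ∧ ¬ SameOrbit (productGroup n H) X Y ∧
        (∃ F ∈ dssNetworks σ n H 1, F X ≠ F Y) ∧
        ∀ b : ℕ, ∀ F ∈ siameseNetworks σ n H b, F X = F Y) ∧
      ∀ b : ℕ, 1 ≤ b →
        approximable (siameseNetworks σ n H b) ⊂ approximable (dssNetworks σ n H b) ∧
        ∃ F ∈ dssNetworks σ n H b, F ∉ approximable (siameseNetworks σ n H b)) := by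
  have hna' : ¬ ∃ α β : ℝ, ∀ t, (⟨σ, hσ⟩ : C(ℝ, ℝ)) t = α * t + β := hna
  refine ⟨⟨productGroup_le_wreathGroup, productGroup_lt_wreathGroup⟩,
    fun b F hF X Y => eq_of_sameOrbit_of_mem_dssNetworks hF,
    fun b F hF X Y => eq_of_sameOrbit_of_mem_siameseNetworks hF,
    fun hu => ⟨universalInvariant_siameseNetworks hna' (hu 1),
      fun X Y hX _ hXY => exists_dssNetwork_ne hna (hu 2) hX hXY⟩,
    fun a e b φ A M hφ hM => siamese_mem_dssNetworks hφ A hM,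
    approximable_siameseNetworks_subset hna', fun hn hH => ?_⟩
  obtain ⟨X, Y, hX, hY, hXY, hne⟩ := exists_sameOrbit_columnSums_ne hn hH
  have hsep : ∀ b, 1 ≤ b → ∃ F ∈ dssNetworks σ n H b, F X ≠ F Y := fun b hb => by
    obtain ⟨F, hF, hFXY⟩ := exists_dssNetwork_ne_of_columnSums (H := H) hna' (by omega) hne b
    exact ⟨F, hF, fun heq => hFXY ⟨0, hb⟩ (congrFun heq _)⟩
  refine ⟨⟨X, Y, hX, hY, hXY, fun h => ?_, hsep 1 le_rfl,
    fun b F hF => eq_of_sameOrbit_of_mem_siameseNetworks hF hXY⟩, fun b hb => ?_⟩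
  -- A DSS network is constant on orbits of the product group, so separation itself shows that the
  -- orbits differ.
  · obtain ⟨F, hF, hFne⟩ := hsep 1 le_rfl
    exact hFne (eq_of_sameOrbit_of_mem_dssNetworks hF h)
  · obtain ⟨F, hF, hFne⟩ := hsep b hb
    have hF' : F ∉ approximable (siameseNetworks σ n H b) := fun h =>
      hFne (eq_of_sameOrbit_of_mem_approximable h hXY)
    exact ⟨⟨approximable_siameseNetworks_subset hna' b,
      fun h => hF' (h (mem_approximable_of_mem hF))⟩, F, hF, hF'⟩
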